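/- **Proposition 3.2.** *Conventions.* For a bialgebra $\Lambda$ over $\mathbb{C}$, the Grothendieck ring $K(\Lambda)$ is the free abelian group on the isomorphism classes $[M]$ of finite-dimensional left $\Lambda$-modules modulo the relations $[M\oplus N]=[M]+[N]$, with multiplication $[M]\cdot[N]=[M\otimes_{\mathbb{C}} N]$, where $\Lambda$ acts on $M\otimes N$ through its comultiplication. Say that a ring $R$ *satisfies the axiomatisation with $I=\{0\}$ and $m=\infty$* for the elements $[0,u]$ ($u\in\mathbb{N}$) if its additive group is free with basis $\{[0,u]\}_{u\in\mathbb{N}}$ and, with the convention $[0,-1]=0$, $$[0,0][0,0]=[0,0],\qquad [0,1][0,v]=[0,v][0,1]=[0,v+1]+[0,v-1]\quad(v\ge 0).$$ *Modules.* Let $X,Y,H$ be the standard basis of $\mathfrak{sl}_2(\mathbb{C})$, and let $U(\mathfrak{sl}_2)$ have the comultiplication $\Delta(x)=x\otimes 1+1\otimes x$ for $x\in\mathfrak{sl}_2(\mathbb{C})$. For $n\in\mathbb{N}$, $V(n)$ is the $U(\mathfrak{sl}_2)$-module with basis $v_0,\dots,v_n$ (and $v_i=0$ for $i\notin\{0,\dots,n\}$)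 and $$Xv_i=(n-i+1)v_{i-1},\quad Yv_i=(i+1)v_{i+1},\quad Hv_i=(n-2i)v_i .$$ For $q\in\mathbb{C}^\times$ not a root of unity, $U_q(\mathfrak{sl}_2)$ is generated by $E,F,K,K^{-1}$ with relations $KK^{-1}=K^{-1}K=1$, $KE=q^2EK$, $KF=q^{-2}FK$, $EF-FE=\frac{K-K^{-1}}{q-q^{-1}}$, with comultiplication $\Delta(E)=1\otimes E+E\otimes K$, $\Delta(F)=K^{-1}\otimes F+F\otimes 1$, $\Delta(K)=K\otimes K$ and counit $\varepsilon(E)=\varepsilon(F)=0$, $\varepsilon(K)=1$. For $\epsilon=\pm1$ and $n\in\mathbb{N}$, $V_{\epsilon,n}$ is the $U_q(\mathfrak{sl}_2)$-module with basis $v_0,\dots,v_n$ (and $v_i=0$ otherwise) and $$Ev_i=\epsilon[n-i+1]v_{i-1},\quad Fv_i=[i+1]v_{i+1},\quad Kv_i=\epsilon q^{n-2i}v_i,\qquad [x]=\frac{q^x-q^{-x}}{q-q^{-1}}.$$ *Claim.* 1. If a ring satisfies the axiomatisation with $I=\{0\}$ and $m=\infty$, then $[0,u][0,v]=\sum_{l=0}^{\min(u,v)}[0,u+v-2l]$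 for all $u,v\in\mathbb{N}$. 2. The axiomatisation applies to $U(\mathfrak{sl}_2)$: the classes $[V(n)]$, $n\in\mathbb{N}$, are a $\mathbb{Z}$-basis of a subring of $K(U(\mathfrak{sl}_2))$ which satisfies the axiomatisation with $[0,n]=[V(n)]$. Moreover, for all $n,m\in\mathbb{N}$, as $U(\mathfrak{sl}_2)$-modules, $$V(n)\otimes V(m)\cong\bigoplus_{l=0}^{\min(n,m)}V(n+m-2l).$$ 3. The axiomatisation applies to $U_q(\mathfrak{sl}_2)$ for every $q\in\mathbb{C}^\times$ that is not a root of unity: the classes $[V_{1,n}]$, $n\in\mathbb{N}$, are a $\mathbb{Z}$-basis of a subring of $K(U_q(\mathfrak{sl}_2))$ which satisfies the axiomatisation with $[0,n]=[V_{1,n}]$. Moreover, for all $\epsilon,\epsilon'\in\{\pm1\}$ and $n,m\in\mathbb{N}$, as $U_q(\mathfrak{sl}_2)$-modules, $$V_{\epsilon,n}\otimes V_{\epsilon',m}\cong\bigoplus_{l=0}^{\min(n,m)}V_{\epsilon\epsilon',n+m-2l}.$$ -/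

import Mathlib

noncomputable section

open scoped TensorProduct

universe u v

namespace ClebschGordan

/-! ### Finite-dimensional modules over a bialgebra -/

/-- A finite-dimensional left module over the `k`-algebra `Λ`: a finite-dimensional vector space
together with a morphism of algebras from `Λ` to its endomorphisms. -/
structure FDMod (k : Type u) [Field k] (Λ : Type v) [Ring Λ] [Algebra k Λ] where
  carrier : Type u
  [addCommGroup : AddCommGroup carrier]
  [module : Module k carrier]
  [finite : Module.Finite k carrier]
  act : Λ →ₐ[k] Module.End k carrier

attribute [instance] FDMod.addCommGroup FDMod.module FDMod.finite

namespace FDMod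

section Basic

variable {k : Type u} [Field k] {Λ : Type v} [Ring Λ] [Algebra k Λ]

/-- Two modules are isomorphic when there is a `Λ`-equivariant linear bijection between them. -/
def Iso (M N : FDMod k Λ) : Prop :=
  ∃ e : M.carrier ≃ₗ[k] N.carrier, ∀ (a : Λ) (x : M.carrier), e (M.act a x) = N.act a (e x)

theorem Iso.refl (M : FDMod k Λ) : M.Iso M := ⟨LinearEquiv.refl _ _, fun _ _ => rfl⟩

theorem Iso.symm {M N : FDMod k Λ} (h : M.Iso N) : N.Iso M := by
  obtain ⟨e, he⟩ := h
  refine ⟨e.symm, fun a x => ?_⟩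
  rw [LinearEquiv.symm_apply_eq, he, LinearEquiv.apply_symm_apply]

theorem Iso.trans {M N P : FDMod k Λ} (h : M.Iso N) (h' : N.Iso P) : M.Iso P := by
  obtain ⟨e, he⟩ := h
  obtain ⟨f, hf⟩ := h'
  exact ⟨e.trans f, fun a x => by simp [he, hf]⟩

instance setoid (k : Type u) [Field k] (Λ : Type v) [Ring Λ] [Algebra k Λ] :
    Setoid (FDMod k Λ) where
  r := Iso
  iseqv := ⟨Iso.refl, Iso.symm, Iso.trans⟩

end Basic

section Unbundled

variable {k : Type u} [Field k] {Λ : Type v} [Ring Λ]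
  {A B C : Type u} [AddCommGroup A] [Module k A] [AddCommGroup B] [Module k B]
  [AddCommGroup C] [Module k C]

/-- The external action of `Λ ⊗ Λ` on the tensor product of two `Λ`-modules. -/
def tensorAct [Algebra k Λ] (ρ : Λ →ₐ[k] Module.End k A) (σ : Λ →ₐ[k] Module.End k B) :
    Λ ⊗[k] Λ →ₐ[k] Module.End k (A ⊗[k] B) :=
  (Module.endTensorEndAlgHom (R := k) (S := k) (A := k)).comp (Algebra.TensorProduct.map ρ σ)

@[simp]
theorem tensorAct_tmul [Algebra k Λ] (ρ : Λ →ₐ[k] Module.End k A) (σ : Λ →ₐ[k] Module.End k B)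
    (a b : Λ) (x : A) (y : B) : tensorAct ρ σ (a ⊗ₜ b) (x ⊗ₜ y) = ρ a x ⊗ₜ σ b y := rfl

/-- The action of `Λ` on the tensor product of two modules, through the comultiplication. -/
def tensorRep [Bialgebra k Λ] (ρ : Λ →ₐ[k] Module.End k A) (σ : Λ →ₐ[k] Module.End k B) :
    Λ →ₐ[k] Module.End k (A ⊗[k] B) :=
  (tensorAct ρ σ).comp (Bialgebra.comulAlgHom k Λ)

theorem tensorRep_apply [Bialgebra k Λ] (ρ : Λ →ₐ[k] Module.End k A)
    (σ : Λ →ₐ[k] Module.End k B) (a : Λ) :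
    tensorRep ρ σ a = tensorAct ρ σ (Coalgebra.comul (R := k) a) := rfl

/-- The action of `Λ` on the ground field, through the counit. -/
def unitRep (k : Type u) [Field k] (Λ : Type v) [Ring Λ] [Bialgebra k Λ] :
    Λ →ₐ[k] Module.End k k :=
  (Algebra.lmul k k).comp (Bialgebra.counitAlgHom k Λ)

theorem unitRep_apply [Bialgebra k Λ] (a : Λ) (x : k) :
    unitRep k Λ a x = Coalgebra.counit (R := k) a * x := rfl

/-- The componentwise action on a product of two modules. -/
def prodRep [Algebra k Λ] (ρ : Λ →ₐ[k] Module.End k A) (σ : Λ →ₐ[k] Module.End k B) :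
    Λ →ₐ[k] Module.End k (A × B) :=
  AlgHom.ofLinearMap
    { toFun := fun a => (ρ a).prodMap (σ a)
      map_add' := fun a b => by ext <;> simp
      map_smul' := fun c a => by ext <;> simp }
    (by ext <;> simp) (fun a b => by ext <;> simp)

theorem prodRep_apply [Algebra k Λ] (ρ : Λ →ₐ[k] Module.End k A) (σ : Λ →ₐ[k] Module.End k B)
    (a : Λ) (x : A × B) : prodRep ρ σ a x = (ρ a x.1, σ a x.2) := rfl

/-- Two linear maps out of tensor products agree as soon as they do on pure tensors. -/
theorem tensor_ind [Algebra k Λ] {D : Type*} [AddCommGroup D] [Module k D]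
    (f g : Λ ⊗[k] Λ →ₗ[k] A ⊗[k] B →ₗ[k] D)
    (h : ∀ a b x y, f (a ⊗ₜ b) (x ⊗ₜ y) = g (a ⊗ₜ b) (x ⊗ₜ y)) : f = g := by
  ext a b x y
  exact h a b x y

theorem tensorRep_congr [Bialgebra k Λ] {A' B' : Type u} [AddCommGroup A'] [Module k A']
    [AddCommGroup B'] [Module k B']
    {ρ : Λ →ₐ[k] Module.End k A} {σ : Λ →ₐ[k] Module.End k B}
    {ρ' : Λ →ₐ[k] Module.End k A'} {σ' : Λ →ₐ[k] Module.End k B'}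
    (e : A ≃ₗ[k] A') (he : ∀ a x, e (ρ a x) = ρ' a (e x))
    (f : B ≃ₗ[k] B') (hf : ∀ a x, f (σ a x) = σ' a (f x)) (a : Λ) (x : A ⊗[k] B) :
    TensorProduct.congr e f (tensorRep ρ σ a x) =
      tensorRep ρ' σ' a (TensorProduct.congr e f x) := by
  have := tensor_ind
    ((tensorAct ρ σ).toLinearMap.compr₂ (TensorProduct.congr e f).toLinearMap)
    ((tensorAct ρ' σ').toLinearMap.compl₂ (TensorProduct.congr e f).toLinearMap)
    (by intro a b x y; simp [he, hf])
  exact LinearMap.congr_fun₂ this (Coalgebra.comul (R := k) a) x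

theorem tensorRep_assoc [Bialgebra k Λ] (ρ : Λ →ₐ[k] Module.End k A)
    (σ : Λ →ₐ[k] Module.End k B) (τ : Λ →ₐ[k] Module.End k C) (a : Λ) (x : (A ⊗[k] B) ⊗[k] C) :
    TensorProduct.assoc k A B C (tensorRep (tensorRep ρ σ) τ a x) =
      tensorRep ρ (tensorRep σ τ) a (TensorProduct.assoc k A B C x) := by
  let Φ : (Λ ⊗[k] (Λ ⊗[k] Λ)) →ₗ[k] Module.End k (A ⊗[k] (B ⊗[k] C)) :=
    ((Module.endTensorEndAlgHom (R := k) (S := k) (A := k)).comp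
      (Algebra.TensorProduct.map ρ (tensorAct σ τ))).toLinearMap
  have hΦ : ∀ a b c x y z, Φ (a ⊗ₜ (b ⊗ₜ c)) (x ⊗ₜ (y ⊗ₜ z)) =
      ρ a x ⊗ₜ (σ b y ⊗ₜ τ c z) := fun _ _ _ _ _ _ => rfl
  have key : ∀ (s : Λ ⊗[k] Λ) (b : Λ) (m : A ⊗[k] B) (p : C),
      TensorProduct.assoc k A B C ((tensorAct ρ σ s m) ⊗ₜ τ b p) =
        Φ (TensorProduct.assoc k Λ Λ Λ (s ⊗ₜ b)) (TensorProduct.assoc k A B C (m ⊗ₜ p)) := by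
    intro s b m p
    induction s with
    | zero => simp
    | add s t hs ht => simp only [map_add, LinearMap.add_apply, TensorProduct.add_tmul, hs, ht]
    | tmul a c =>
      induction m with
      | zero => simp
      | add x y hx hy => simp only [map_add, TensorProduct.add_tmul, hx, hy]
      | tmul x y => simp [hΦ]
  have hL := tensor_ind
    ((tensorAct (tensorRep ρ σ) τ).toLinearMap.compr₂ (TensorProduct.assoc k A B C).toLinearMap)
    ((Φ ∘ₗ (TensorProduct.assoc k Λ Λ Λ).toLinearMap ∘ₗ
      (Coalgebra.comul (R := k)).rTensor Λ).compl₂ (TensorProduct.assoc k A B C).toLinearMap)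
    (by intro a b x y; exact key _ _ _ _)
  have hR := tensor_ind (tensorAct ρ (tensorRep σ τ)).toLinearMap
    (Φ ∘ₗ (Coalgebra.comul (R := k)).lTensor Λ) (by intro a b x y; rfl)
  refine (LinearMap.congr_fun₂ hL (Coalgebra.comul (R := k) a) x).trans ?_
  refine Eq.trans ?_ (LinearMap.congr_fun₂ hR (Coalgebra.comul (R := k) a) _).symm
  exact congrArg (fun t => Φ t (TensorProduct.assoc k A B C x)) (Coalgebra.coassoc_apply a)

theorem unitRep_tensorRep [Bialgebra k Λ] (ρ : Λ →ₐ[k] Module.End k A) (a : Λ) (x : k ⊗[k] A) :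
    TensorProduct.lid k A (tensorRep (unitRep k Λ) ρ a x) = ρ a (TensorProduct.lid k A x) := by
  have h := tensor_ind
    ((tensorAct (unitRep k Λ) ρ).toLinearMap.compr₂ (TensorProduct.lid k A).toLinearMap)
    ((ρ.toLinearMap ∘ₗ (TensorProduct.lid k Λ).toLinearMap ∘ₗ
      (Coalgebra.counit (R := k)).rTensor Λ).compl₂ (TensorProduct.lid k A).toLinearMap)
    (by intro a b x y; simp [unitRep_apply, mul_smul]; rw [smul_comm])
  refine (LinearMap.congr_fun₂ h (Coalgebra.comul (R := k) a) x).trans ?_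
  simp

theorem tensorRep_unitRep [Bialgebra k Λ] (ρ : Λ →ₐ[k] Module.End k A) (a : Λ) (x : A ⊗[k] k) :
    TensorProduct.rid k A (tensorRep ρ (unitRep k Λ) a x) = ρ a (TensorProduct.rid k A x) := by
  have h := tensor_ind
    ((tensorAct ρ (unitRep k Λ)).toLinearMap.compr₂ (TensorProduct.rid k A).toLinearMap)
    ((ρ.toLinearMap ∘ₗ (TensorProduct.rid k Λ).toLinearMap ∘ₗ
      (Coalgebra.counit (R := k)).lTensor Λ).compl₂ (TensorProduct.rid k A).toLinearMap)
    (by intro a b x y; simp [unitRep_apply, mul_smul]; rw [smul_comm])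
  refine (LinearMap.congr_fun₂ h (Coalgebra.comul (R := k) a) x).trans ?_
  simp

theorem tensorRep_prodRep [Bialgebra k Λ] (ρ : Λ →ₐ[k] Module.End k A)
    (σ : Λ →ₐ[k] Module.End k B) (τ : Λ →ₐ[k] Module.End k C) (a : Λ) (x : A ⊗[k] (B × C)) :
    TensorProduct.prodRight k k A B C (tensorRep ρ (prodRep σ τ) a x) =
      prodRep (tensorRep ρ σ) (tensorRep ρ τ) a (TensorProduct.prodRight k k A B C x) := by
  let e := (TensorProduct.prodRight k k A B C).toLinearMap
  have h1 := tensor_ind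
    ((tensorAct ρ (prodRep σ τ)).toLinearMap.compr₂ (LinearMap.fst k _ _ ∘ₗ e))
    ((tensorAct ρ σ).toLinearMap.compl₂ (LinearMap.fst k _ _ ∘ₗ e))
    (by intro a b x y; simp [e, prodRep_apply])
  have h2 := tensor_ind
    ((tensorAct ρ (prodRep σ τ)).toLinearMap.compr₂ (LinearMap.snd k _ _ ∘ₗ e))
    ((tensorAct ρ τ).toLinearMap.compl₂ (LinearMap.snd k _ _ ∘ₗ e))
    (by intro a b x y; simp [e, prodRep_apply])
  exact Prod.ext (LinearMap.congr_fun₂ h1 (Coalgebra.comul (R := k) a) x)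
    (LinearMap.congr_fun₂ h2 (Coalgebra.comul (R := k) a) x)

theorem prodRep_tensorRep [Bialgebra k Λ] (ρ : Λ →ₐ[k] Module.End k A)
    (σ : Λ →ₐ[k] Module.End k B) (τ : Λ →ₐ[k] Module.End k C) (a : Λ) (x : (A × B) ⊗[k] C) :
    TensorProduct.prodLeft k k A B C (tensorRep (prodRep ρ σ) τ a x) =
      prodRep (tensorRep ρ τ) (tensorRep σ τ) a (TensorProduct.prodLeft k k A B C x) := by
  let e := (TensorProduct.prodLeft k k A B C).toLinearMap
  have h1 := tensor_ind
    ((tensorAct (prodRep ρ σ) τ).toLinearMap.compr₂ (LinearMap.fst k _ _ ∘ₗ e))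
    ((tensorAct ρ τ).toLinearMap.compl₂ (LinearMap.fst k _ _ ∘ₗ e))
    (by rintro a b ⟨x, x'⟩ y; simp [e, prodRep_apply])
  have h2 := tensor_ind
    ((tensorAct (prodRep ρ σ) τ).toLinearMap.compr₂ (LinearMap.snd k _ _ ∘ₗ e))
    ((tensorAct σ τ).toLinearMap.compl₂ (LinearMap.snd k _ _ ∘ₗ e))
    (by rintro a b ⟨x, x'⟩ y; simp [e, prodRep_apply])
  exact Prod.ext (LinearMap.congr_fun₂ h1 (Coalgebra.comul (R := k) a) x)
    (LinearMap.congr_fun₂ h2 (Coalgebra.comul (R := k) a) x)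

end Unbundled

section Bundled

/-- The direct sum of two modules. -/
def prod {k : Type u} [Field k] {Λ : Type v} [Ring Λ] [Algebra k Λ] (M N : FDMod k Λ) :
    FDMod k Λ where
  carrier := M.carrier × N.carrier
  act := prodRep M.act N.act

/-- The direct sum of a finite family of modules, with the componentwise action. -/
def directSum {k : Type u} [Field k] {Λ : Type v} [Ring Λ] [Algebra k Λ] {n : ℕ}
    (M : Fin n → FDMod k Λ) : FDMod k Λ where
  carrier := ∀ l, (M l).carrier
  act := AlgHom.ofLinearMap
    { toFun := fun a => LinearMap.pi fun l => (M l).act a ∘ₗ LinearMap.proj l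
      map_add' := fun a b => by ext x l; simp
      map_smul' := fun c a => by ext x l; simp }
    (by ext x l; simp) (fun a b => by ext x l; simp)

variable {k : Type u} [Field k] {Λ : Type v} [Ring Λ] [Bialgebra k Λ]

/-- The tensor product over the ground field of two modules: `Λ` acts through the
comultiplication. -/
def tensor (M N : FDMod k Λ) : FDMod k Λ where
  carrier := M.carrier ⊗[k] N.carrier
  act := tensorRep M.act N.act

/-- The trivial one-dimensional module: `Λ` acts through the counit. -/
def unit (k : Type u) [Field k] (Λ : Type v) [Ring Λ] [Bialgebra k Λ] : FDMod k Λ where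
  carrier := k
  act := unitRep k Λ

theorem tensor_congr {M M' N N' : FDMod k Λ} (h : M.Iso M') (h' : N.Iso N') :
    (tensor M N).Iso (tensor M' N') := by
  obtain ⟨e, he⟩ := h
  obtain ⟨f, hf⟩ := h'
  exact ⟨TensorProduct.congr e f, tensorRep_congr e he f hf⟩

theorem tensor_assoc (M N P : FDMod k Λ) :
    (tensor (tensor M N) P).Iso (tensor M (tensor N P)) :=
  ⟨TensorProduct.assoc k _ _ _, tensorRep_assoc M.act N.act P.act⟩

theorem unit_tensor (M : FDMod k Λ) : (tensor (unit k Λ) M).Iso M :=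
  ⟨TensorProduct.lid k _, unitRep_tensorRep M.act⟩

theorem tensor_unit (M : FDMod k Λ) : (tensor M (unit k Λ)).Iso M :=
  ⟨TensorProduct.rid k _, tensorRep_unitRep M.act⟩

theorem tensor_prod (M N P : FDMod k Λ) :
    (tensor M (prod N P)).Iso (prod (tensor M N) (tensor M P)) :=
  ⟨TensorProduct.prodRight k k _ _ _, tensorRep_prodRep M.act N.act P.act⟩

theorem prod_tensor (M N P : FDMod k Λ) :
    (tensor (prod M N) P).Iso (prod (tensor M P) (tensor N P)) :=
  ⟨TensorProduct.prodLeft k k _ _ _, prodRep_tensorRep M.act N.act P.act⟩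

end Bundled

end FDMod

/-! ### The Grothendieck ring -/

section Grothendieck

variable (k : Type u) [Field k] (Λ : Type v) [Ring Λ]

/-- Isomorphism classes of finite-dimensional `Λ`-modules. -/
def IsoClass [Algebra k Λ] : Type (max (u + 1) v) := Quotient (FDMod.setoid k Λ)

variable [Bialgebra k Λ]

/-- The isomorphism classes form a monoid for the tensor product. -/
instance IsoClass.monoid : Monoid (IsoClass k Λ) where
  mul := Quotient.map₂ FDMod.tensor fun _ _ h _ _ h' => FDMod.tensor_congr h h'
  one := Quotient.mk _ (FDMod.unit k Λ)
  mul_assoc := by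
    rintro ⟨M⟩ ⟨N⟩ ⟨P⟩
    exact Quotient.sound (FDMod.tensor_assoc M N P)
  one_mul := by
    rintro ⟨M⟩
    exact Quotient.sound (FDMod.unit_tensor M)
  mul_one := by
    rintro ⟨M⟩
    exact Quotient.sound (FDMod.tensor_unit M)

/-- The generator `[M]` of the free abelian group on the isomorphism classes. -/
def freeClass {k : Type u} [Field k] {Λ : Type v} [Ring Λ] [Algebra k Λ] (M : FDMod k Λ) :
    FreeAbelianGroup (IsoClass k Λ) :=
  FreeAbelianGroup.of (Quotient.mk _ M)

theorem freeClass_mul {k : Type u} [Field k] {Λ : Type v} [Ring Λ] [Bialgebra k Λ]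
    (M N : FDMod k Λ) : freeClass M * freeClass N = freeClass (M.tensor N) :=
  FreeAbelianGroup.of_mul_of _ _

theorem freeClass_eq {k : Type u} [Field k] {Λ : Type v} [Ring Λ] [Algebra k Λ]
    {M N : FDMod k Λ} (h : M.Iso N) : freeClass M = freeClass N :=
  congrArg FreeAbelianGroup.of (Quotient.sound h)

/-- The subgroup generated by the elements `[X ⊕ Y] - [X] - [Y]`, one for each split exact
sequence `X → X ⊕ Y → Y`. -/
def splitRelations (k : Type u) [Field k] (Λ : Type v) [Ring Λ] [Algebra k Λ] :
    AddSubgroup (FreeAbelianGroup (IsoClass k Λ)) :=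
  AddSubgroup.closure
    {x | ∃ X Y : FDMod k Λ, x = freeClass (X.prod Y) - freeClass X - freeClass Y}

theorem splitRelations_mul_left {x y : FreeAbelianGroup (IsoClass k Λ)}
    (hy : y ∈ splitRelations k Λ) : x * y ∈ splitRelations k Λ := by
  induction hy using AddSubgroup.closure_induction with
  | zero => simp [zero_mem]
  | add a b _ _ ha hb => rw [mul_add]; exact add_mem ha hb
  | neg a _ ha => rw [mul_neg]; exact neg_mem ha
  | mem y hy =>
    obtain ⟨X, Y, rfl⟩ := hy
    induction x using FreeAbelianGroup.induction_on with
    | zero => simp [zero_mem]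
    | add a b ha hb => rw [add_mul]; exact add_mem ha hb
    | neg a ha => rw [neg_mul]; exact neg_mem ha
    | of z =>
      induction z using Quotient.inductionOn with
      | h Z =>
        change freeClass Z * _ ∈ _
        rw [mul_sub, mul_sub, freeClass_mul, freeClass_mul, freeClass_mul,
          freeClass_eq (FDMod.tensor_prod Z X Y)]
        exact AddSubgroup.subset_closure ⟨_, _, rfl⟩

theorem splitRelations_mul_right {x y : FreeAbelianGroup (IsoClass k Λ)}
    (hx : x ∈ splitRelations k Λ) : x * y ∈ splitRelations k Λ := by
  induction hx using AddSubgroup.closure_induction with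
  | zero => simp [zero_mem]
  | add a b _ _ ha hb => rw [add_mul]; exact add_mem ha hb
  | neg a _ ha => rw [neg_mul]; exact neg_mem ha
  | mem x hx =>
    obtain ⟨X, Y, rfl⟩ := hx
    induction y using FreeAbelianGroup.induction_on with
    | zero => simp [zero_mem]
    | add a b ha hb => rw [mul_add]; exact add_mem ha hb
    | neg a ha => rw [mul_neg]; exact neg_mem ha
    | of z =>
      induction z using Quotient.inductionOn with
      | h Z =>
        change _ * freeClass Z ∈ _
        rw [sub_mul, sub_mul, freeClass_mul, freeClass_mul, freeClass_mul,
          freeClass_eq (FDMod.prod_tensor X Y Z)]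
        exact AddSubgroup.subset_closure ⟨_, _, rfl⟩

/-- The subgroup of split relations, as a two-sided ideal. -/
def splitIdeal : TwoSidedIdeal (FreeAbelianGroup (IsoClass k Λ)) :=
  TwoSidedIdeal.mk' (splitRelations k Λ : Set (FreeAbelianGroup (IsoClass k Λ)))
    (zero_mem _) add_mem neg_mem (splitRelations_mul_left k Λ) (splitRelations_mul_right k Λ)

/-- The Grothendieck ring of the bialgebra `Λ`: the free abelian group on the isomorphism classes
of finite-dimensional modules modulo the split relations, multiplied by the tensor product. -/
abbrev GrothendieckRing : Type (max (u + 1) v) := (splitIdeal k Λ).ringCon.Quotient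

end Grothendieck

/-- The class `[M]` in the Grothendieck ring. -/
def FDMod.cls {k : Type u} [Field k] {Λ : Type v} [Ring Λ] [Bialgebra k Λ] (M : FDMod k Λ) :
    GrothendieckRing k Λ :=
  (splitIdeal k Λ).ringCon.mk' (freeClass M)

/-! ### The axiomatisation -/

/-- The index set `J_m`: all of `ℕ` when `m = ∞`, and `{0, …, m - 1}` when `m` is finite. -/
abbrev J (m : ℕ∞) : Type := {w : ℕ // (w : ℕ∞) < m}

section Axioms

variable {I : Type} {m : ℕ∞} {R : Type u} [Ring R]

/-- The symbol `[i, w]`, for an integer `w`: the basis element indexed by `(i, w)`, with the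
convention `[i, w] = 0` when `w < 0` (more generally, when `w ∉ J_m`). -/
def sym (b : Module.Basis (I × J m) ℤ R) (i : I) (w : ℤ) : R :=
  if h : 0 ≤ w ∧ ((w.toNat : ℕ) : ℕ∞) < m then b (i, ⟨w.toNat, h.2⟩) else 0

/-- The relations imposed on a ring whose additive group is free on the elements `[i, w]`,
`(i, w) ∈ I × J_m`, including their mirror images with respect to the multiplication. -/
structure TensorAxioms [AddCommGroup I] [One I] (b : Module.Basis (I × J m) ℤ R) : Prop where
  zero_mul_zero : ∀ i j : I, sym b i 0 * sym b j 0 = sym b (i + j) 0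
  one_mul : ∀ (j : I) (w : ℕ), ((w + 1 : ℕ) : ℕ∞) < m →
    sym b 0 1 * sym b j w = sym b j (w + 1) + sym b (j + 1) (w - 1)
  mul_one : ∀ (j : I) (w : ℕ), ((w + 1 : ℕ) : ℕ∞) < m →
    sym b j w * sym b 0 1 = sym b j (w + 1) + sym b (j + 1) (w - 1)
  one_mul_last : ∀ (j : I) (w : ℕ), ((w + 1 : ℕ) : ℕ∞) = m →
    sym b 0 1 * sym b j w = sym b j w + sym b (j + 1) w
  mul_one_last : ∀ (j : I) (w : ℕ), ((w + 1 : ℕ) : ℕ∞) = m →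
    sym b j w * sym b 0 1 = sym b j w + sym b (j + 1) w

end Axioms

/-! ### The basis vectors `v_i` -/

/-- The vector `v_i` of the space with basis `v_0, …, v_n`, with `v_i = 0` for
`i ∉ {0, …, n}`. -/
def vec (n : ℕ) (i : ℤ) : Fin (n + 1) → ℂ := fun s => if ((s : ℕ) : ℤ) = i then 1 else 0

/-- The linear map with `v_i ↦ c i • v_{i + d}` for `0 ≤ i ≤ n`. -/
def weighted (n : ℕ) (d : ℤ) (c : ℤ → ℂ) : Module.End ℂ (Fin (n + 1) → ℂ) :=
  (Pi.basisFun ℂ (Fin (n + 1))).constr ℂ fun i => c (i : ℕ) • vec n ((i : ℕ) + d)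

theorem vec_natCast (n : ℕ) (i : Fin (n + 1)) : vec n ((i : ℕ) : ℤ) = Pi.single i 1 := by
  ext s
  by_cases h : s = i
  · subst h; simp [vec]
  · have : (s : ℕ) ≠ i := fun h' => h (Fin.ext h')
    simp [vec, h, this]

theorem vec_eq_zero (n : ℕ) (i : ℤ) (h : i < 0 ∨ (n : ℤ) < i) : vec n i = 0 := by
  ext s
  have := s.2
  simp only [vec, Pi.zero_apply, ite_eq_right_iff]
  intro h'
  omega

theorem weighted_vec_of_mem (n : ℕ) (d : ℤ) (c : ℤ → ℂ) (i : ℤ) (h0 : 0 ≤ i) (h1 : i ≤ n) :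
    weighted n d c (vec n i) = c i • vec n (i + d) := by
  obtain ⟨j, rfl⟩ := Int.eq_ofNat_of_zero_le h0
  have hj : j < n + 1 := by omega
  have := (Pi.basisFun ℂ (Fin (n + 1))).constr_basis ℂ
    (fun i => c (i : ℕ) • vec n ((i : ℕ) + d)) ⟨j, hj⟩
  rw [Pi.basisFun_apply, ← vec_natCast] at this
  exact this

/-- The formula for `weighted` holds for every integer index, as soon as it does at the two ends. -/
theorem weighted_vec (n : ℕ) (d : ℤ) (c : ℤ → ℂ) (i : ℤ)
    (h : (i < 0 ∨ (n : ℤ) < i) → c i = 0 ∨ i + d < 0 ∨ (n : ℤ) < i + d) :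
    weighted n d c (vec n i) = c i • vec n (i + d) := by
  by_cases hi : i < 0 ∨ (n : ℤ) < i
  · rw [vec_eq_zero n i hi, map_zero]
    rcases h hi with h | h
    · rw [h, zero_smul]
    · rw [vec_eq_zero n _ h, smul_zero]
  · exact weighted_vec_of_mem n d c i (by omega) (by omega)

theorem weighted_zero_vec (n : ℕ) (c : ℤ → ℂ) (i : ℤ) :
    weighted n 0 c (vec n i) = c i • vec n i := by
  have := weighted_vec n 0 c i fun h => by right; omega
  rwa [add_zero] at this

theorem end_ext {n : ℕ} {f g : Module.End ℂ (Fin (n + 1) → ℂ)}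
    (h : ∀ i : ℤ, 0 ≤ i → i ≤ n → f (vec n i) = g (vec n i)) : f = g := by
  refine (Pi.basisFun ℂ (Fin (n + 1))).ext fun i => ?_
  rw [Pi.basisFun_apply, ← vec_natCast]
  exact h _ (by positivity) (by have := i.2; omega)

/-! ### The enveloping algebra of `sl₂` and its modules `V(n)` -/

section Enveloping

attribute [local instance] LieRing.ofAssociativeRing

variable (R : Type u) [CommRing R] (L : Type v) [LieRing L] [LieAlgebra R L]

/-- The comultiplication of an enveloping algebra: `Δ x = x ⊗ 1 + 1 ⊗ x` for `x ∈ L`. -/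
def envComul : (UniversalEnvelopingAlgebra R L) →ₐ[R] (UniversalEnvelopingAlgebra R L) ⊗[R] (UniversalEnvelopingAlgebra R L) :=
  UniversalEnvelopingAlgebra.lift R
    { toFun := fun x => UniversalEnvelopingAlgebra.ι R x ⊗ₜ 1 +
        1 ⊗ₜ UniversalEnvelopingAlgebra.ι R x
      map_add' := fun x y => by
        simp only [map_add, TensorProduct.add_tmul, TensorProduct.tmul_add]; abel
      map_smul' := fun c x => by
        simp only [map_smul, TensorProduct.smul_tmul', TensorProduct.tmul_smul, smul_add,
          RingHom.id_apply]
      map_lie' := fun {x y} => by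
        simp only [LieHom.map_lie, LieRing.of_associative_ring_bracket, add_mul, mul_add,
          Algebra.TensorProduct.tmul_mul_tmul, one_mul, mul_one, TensorProduct.sub_tmul,
          TensorProduct.tmul_sub]
        abel }

/-- The counit of an enveloping algebra: `ε x = 0` for `x ∈ L`. -/
def envCounit : (UniversalEnvelopingAlgebra R L) →ₐ[R] R := UniversalEnvelopingAlgebra.lift R 0

@[simp]
theorem envComul_ι (x : L) : envComul R L (UniversalEnvelopingAlgebra.ι R x) =
    UniversalEnvelopingAlgebra.ι R x ⊗ₜ 1 + 1 ⊗ₜ UniversalEnvelopingAlgebra.ι R x :=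
  UniversalEnvelopingAlgebra.lift_ι_apply R _ x

@[simp]
theorem envCounit_ι (x : L) : envCounit R L (UniversalEnvelopingAlgebra.ι R x) = 0 :=
  UniversalEnvelopingAlgebra.lift_ι_apply R _ x

theorem env_hom_ext {A : Type*} [Ring A] [Algebra R A] {f g : (UniversalEnvelopingAlgebra R L) →ₐ[R] A}
    (h : ∀ x, f (UniversalEnvelopingAlgebra.ι R x) = g (UniversalEnvelopingAlgebra.ι R x)) :
    f = g :=
  UniversalEnvelopingAlgebra.hom_ext R (LieHom.ext h)

instance envBialgebra : Bialgebra R (UniversalEnvelopingAlgebra R L) :=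
  Bialgebra.ofAlgHom (envComul R L) (envCounit R L)
    (env_hom_ext R L fun x => by
      simp [-UniversalEnvelopingAlgebra.ι_apply, TensorProduct.add_tmul, TensorProduct.tmul_add,
        Algebra.TensorProduct.one_def, add_assoc])
    (env_hom_ext R L fun x => by simp [-UniversalEnvelopingAlgebra.ι_apply])
    (env_hom_ext R L fun x => by simp [-UniversalEnvelopingAlgebra.ι_apply])

end Enveloping

/-- The enveloping algebra `U(sl₂(ℂ))`. -/
abbrev Usl2 : Type :=
  UniversalEnvelopingAlgebra ℂ (LieAlgebra.SpecialLinear.sl (Fin 2) ℂ)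

section Vn

/-- `X v_i = (n - i + 1) v_{i-1}` -/
def opX (n : ℕ) : Module.End ℂ (Fin (n + 1) → ℂ) := weighted n (-1) fun i => n - i + 1

/-- `Y v_i = (i + 1) v_{i+1}` -/
def opY (n : ℕ) : Module.End ℂ (Fin (n + 1) → ℂ) := weighted n 1 fun i => i + 1

/-- `H v_i = (n - 2i) v_i` -/
def opH (n : ℕ) : Module.End ℂ (Fin (n + 1) → ℂ) := weighted n 0 fun i => n - 2 * i

theorem opX_vec (n : ℕ) (i : ℤ) : opX n (vec n i) = ((n : ℂ) - i + 1) • vec n (i - 1) := by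
  refine weighted_vec n (-1) _ i fun h => ?_
  by_cases hi : i = n + 1
  · left; rw [hi]; push_cast; ring
  · omega

theorem opY_vec (n : ℕ) (i : ℤ) : opY n (vec n i) = ((i : ℂ) + 1) • vec n (i + 1) := by
  refine weighted_vec n 1 _ i fun h => ?_
  by_cases hi : i = -1
  · left; rw [hi]; push_cast; ring
  · omega

theorem opH_vec (n : ℕ) (i : ℤ) : opH n (vec n i) = ((n : ℂ) - 2 * i) • vec n i :=
  weighted_zero_vec n _ i

theorem opX_opY (n : ℕ) : opX n * opY n - opY n * opX n = opH n := by
  refine end_ext fun i _ _ => ?_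
  simp only [LinearMap.sub_apply, Module.End.mul_apply, opX_vec, opY_vec, opH_vec, map_smul,
    smul_smul, add_sub_cancel_right, sub_add_cancel, ← sub_smul]
  congr 1
  push_cast
  ring

theorem opH_opX (n : ℕ) : opH n * opX n - opX n * opH n = (2 : ℂ) • opX n := by
  refine end_ext fun i _ _ => ?_
  simp only [LinearMap.sub_apply, LinearMap.smul_apply, Module.End.mul_apply, opX_vec, opH_vec,
    map_smul, smul_smul, ← sub_smul]
  congr 1
  push_cast
  ring

theorem opH_opY (n : ℕ) : opH n * opY n - opY n * opH n = (-2 : ℂ) • opY n := by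
  refine end_ext fun i _ _ => ?_
  simp only [LinearMap.sub_apply, LinearMap.smul_apply, Module.End.mul_apply, opY_vec, opH_vec,
    map_smul, smul_smul, ← sub_smul]
  congr 1
  push_cast
  ring

attribute [local instance] LieRing.ofAssociativeRing

/-- The representation of `sl₂(ℂ)` on `V(n)`: the matrix `!![a, b; c, -a]` is
`a H + b X + c Y`. -/
def sl2Rep (n : ℕ) :
    LieAlgebra.SpecialLinear.sl (Fin 2) ℂ →ₗ⁅ℂ⁆ Module.End ℂ (Fin (n + 1) → ℂ) where
  toFun A := A.1 0 0 • opH n + A.1 0 1 • opX n + A.1 1 0 • opY n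
  map_add' A B := by
    simp only [AddMemClass.coe_add, Matrix.add_apply, add_smul]; abel
  map_smul' c A := by
    simp [smul_add, smul_smul]
  map_lie' {A B} := by
    have hA : A.1 1 1 = - A.1 0 0 := by
      have : Matrix.trace A.1 = 0 := A.2
      rw [Matrix.trace_fin_two] at this
      linear_combination this
    have hB : B.1 1 1 = - B.1 0 0 := by
      have : Matrix.trace B.1 = 0 := B.2
      rw [Matrix.trace_fin_two] at this
      linear_combination this
    have h1 : ⁅A, B⁆.1 = A.1 * B.1 - B.1 * A.1 := rfl
    have e1 := opX_opY n
    have e2 := opH_opX n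
    have e3 := opH_opY n
    rw [h1, LieRing.of_associative_ring_bracket]
    simp only [Matrix.sub_apply, Matrix.mul_apply, Fin.sum_univ_two, hA, hB]
    generalize A.1 0 0 = a, A.1 0 1 = b, A.1 1 0 = c
    generalize B.1 0 0 = a', B.1 0 1 = b', B.1 1 0 = c'
    have expand : (a • opH n + b • opX n + c • opY n) * (a' • opH n + b' • opX n + c' • opY n) -
        (a' • opH n + b' • opX n + c' • opY n) * (a • opH n + b • opX n + c • opY n) =
        (a * b' - b * a') • (opH n * opX n - opX n * opH n) +
        (a * c' - c * a') • (opH n * opY n - opY n * opH n) +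
        (b * c' - c * b') • (opX n * opY n - opY n * opX n) := by
      simp only [add_mul, mul_add, smul_mul_smul_comm, sub_smul, smul_sub]
      simp only [mul_comm]
      abel
    rw [expand, e1, e2, e3]
    module

/-- The `U(sl₂(ℂ))`-module `V(n)`, of dimension `n + 1`. -/
def V (n : ℕ) : FDMod ℂ Usl2 where
  carrier := Fin (n + 1) → ℂ
  act := UniversalEnvelopingAlgebra.lift ℂ (sl2Rep n)

end Vn

/-! ### The quantum enveloping algebra `U_q(sl₂)` -/

/-- The generators `E`, `F`, `K`, `K⁻¹`. -/
inductive Gen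
  | E | F | K | Kinv

section Quantum

open FreeAlgebra in
/-- The defining relations of `U_q(sl₂(ℂ))`. -/
inductive QRel (q : ℂˣ) : FreeAlgebra ℂ Gen → FreeAlgebra ℂ Gen → Prop
  | K_Kinv : QRel q (ι ℂ Gen.K * ι ℂ Gen.Kinv) 1
  | Kinv_K : QRel q (ι ℂ Gen.Kinv * ι ℂ Gen.K) 1
  | K_E : QRel q (ι ℂ Gen.K * ι ℂ Gen.E) ((q : ℂ) ^ 2 • (ι ℂ Gen.E * ι ℂ Gen.K))
  | K_F : QRel q (ι ℂ Gen.K * ι ℂ Gen.F) ((q : ℂ) ^ (-2 : ℤ) • (ι ℂ Gen.F * ι ℂ Gen.K))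
  | E_F : QRel q (ι ℂ Gen.E * ι ℂ Gen.F - ι ℂ Gen.F * ι ℂ Gen.E)
      (((q : ℂ) - (q : ℂ)⁻¹)⁻¹ • (ι ℂ Gen.K - ι ℂ Gen.Kinv))

/-- The algebra `U_q(sl₂(ℂ))`, presented by generators and relations (used for `q ≠ ±1`). -/
abbrev Uq (q : ℂˣ) : Type := RingQuot (QRel q)

namespace Uq

variable (q : ℂˣ)

/-- The image of a generator in `U_q(sl₂)`. -/
def gen (g : Gen) : Uq q := RingQuot.mkAlgHom ℂ (QRel q) (FreeAlgebra.ι ℂ g)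

theorem K_Kinv : gen q .K * gen q .Kinv = 1 := by
  simpa [gen] using RingQuot.mkAlgHom_rel ℂ (QRel.K_Kinv (q := q))

theorem Kinv_K : gen q .Kinv * gen q .K = 1 := by
  simpa [gen] using RingQuot.mkAlgHom_rel ℂ (QRel.Kinv_K (q := q))

theorem K_E : gen q .K * gen q .E = (q : ℂ) ^ 2 • (gen q .E * gen q .K) := by
  simpa only [gen, map_mul, map_smul] using RingQuot.mkAlgHom_rel ℂ (QRel.K_E (q := q))

theorem K_F : gen q .K * gen q .F = (q : ℂ) ^ (-2 : ℤ) • (gen q .F * gen q .K) := by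
  simpa only [gen, map_mul, map_smul] using RingQuot.mkAlgHom_rel ℂ (QRel.K_F (q := q))

theorem E_F : gen q .E * gen q .F - gen q .F * gen q .E =
    ((q : ℂ) - (q : ℂ)⁻¹)⁻¹ • (gen q .K - gen q .Kinv) := by
  simpa only [gen, map_mul, map_smul, map_sub] using
    RingQuot.mkAlgHom_rel ℂ (QRel.E_F (q := q))

/-- A morphism of algebras out of `U_q(sl₂)`, from the images of the generators. -/
def lift {A : Type*} [Ring A] [Algebra ℂ A] (f : Gen → A)
    (h1 : f .K * f .Kinv = 1) (h2 : f .Kinv * f .K = 1)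
    (h3 : f .K * f .E = (q : ℂ) ^ 2 • (f .E * f .K))
    (h4 : f .K * f .F = (q : ℂ) ^ (-2 : ℤ) • (f .F * f .K))
    (h5 : f .E * f .F - f .F * f .E = ((q : ℂ) - (q : ℂ)⁻¹)⁻¹ • (f .K - f .Kinv)) :
    Uq q →ₐ[ℂ] A :=
  RingQuot.liftAlgHom ℂ ⟨FreeAlgebra.lift ℂ f, by
    intro x y h
    cases h
    · simpa using h1
    · simpa using h2
    · simpa using h3
    · simpa using h4
    · simpa using h5⟩

@[simp]
theorem lift_gen {A : Type*} [Ring A] [Algebra ℂ A] (f : Gen → A) (h1 h2 h3 h4 h5) (g : Gen) :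
    lift q f h1 h2 h3 h4 h5 (gen q g) = f g := by
  simp [lift, gen]

theorem hom_ext {A : Type*} [Semiring A] [Algebra ℂ A] {φ ψ : Uq q →ₐ[ℂ] A}
    (h : ∀ g, φ (gen q g) = ψ (gen q g)) : φ = ψ := by
  refine RingQuot.ringQuot_ext' ℂ φ ψ ?_
  ext g
  exact h g

/-- The comultiplication on the generators. -/
def comulGen : Gen → Uq q ⊗[ℂ] Uq q
  | .E => 1 ⊗ₜ gen q .E + gen q .E ⊗ₜ gen q .K
  | .F => gen q .Kinv ⊗ₜ gen q .F + gen q .F ⊗ₜ 1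
  | .K => gen q .K ⊗ₜ gen q .K
  | .Kinv => gen q .Kinv ⊗ₜ gen q .Kinv

theorem E_Kinv : gen q .E * gen q .Kinv = (q : ℂ) ^ 2 • (gen q .Kinv * gen q .E) := by
  calc gen q .E * gen q .Kinv
      = gen q .Kinv * (gen q .K * gen q .E) * gen q .Kinv := by
        rw [← mul_assoc, Kinv_K, one_mul]
    _ = (q : ℂ) ^ 2 • (gen q .Kinv * gen q .E * (gen q .K * gen q .Kinv)) := by
        rw [K_E]; simp only [mul_smul_comm, smul_mul_assoc, mul_assoc]
    _ = _ := by rw [K_Kinv, mul_one]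

theorem K_K_Kinv : gen q .K * gen q .Kinv = gen q .Kinv * gen q .K := by
  rw [K_Kinv, Kinv_K]

/-- `Δ E = 1 ⊗ E + E ⊗ K`, `Δ F = K⁻¹ ⊗ F + F ⊗ 1`, `Δ K = K ⊗ K`. -/
def comul : Uq q →ₐ[ℂ] Uq q ⊗[ℂ] Uq q :=
  lift q (comulGen q)
    (by simp [comulGen, K_Kinv, Algebra.TensorProduct.one_def])
    (by simp [comulGen, Kinv_K, Algebra.TensorProduct.one_def])
    (by
      simp only [comulGen, mul_add, add_mul, Algebra.TensorProduct.tmul_mul_tmul, mul_one, one_mul,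
        K_E, TensorProduct.tmul_smul, TensorProduct.smul_tmul', smul_add])
    (by
      simp only [comulGen, mul_add, add_mul, Algebra.TensorProduct.tmul_mul_tmul, mul_one, one_mul,
        K_F, K_K_Kinv, TensorProduct.tmul_smul, TensorProduct.smul_tmul', smul_add])
    (by
      have hq : (q : ℂ) ^ (-2 : ℤ) * (q : ℂ) ^ 2 = 1 := by
        have := q.ne_zero
        rw [zpow_neg, inv_mul_eq_one₀ (zpow_ne_zero _ this)]
        norm_cast
      have e1 : (gen q .E * gen q .Kinv) ⊗ₜ[ℂ] (gen q .K * gen q .F) =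
          (gen q .Kinv * gen q .E) ⊗ₜ[ℂ] (gen q .F * gen q .K) := by
        rw [E_Kinv, K_F, TensorProduct.smul_tmul_smul, mul_comm, hq, one_smul]
      have e2 : gen q .E * gen q .F = gen q .F * gen q .E +
        ((q : ℂ) - (q : ℂ)⁻¹)⁻¹ • (gen q .K - gen q .Kinv) := by
        rw [← E_F]; abel
      simp only [comulGen, mul_add, add_mul, Algebra.TensorProduct.tmul_mul_tmul, mul_one, one_mul,
        e1, e2]
      simp only [TensorProduct.tmul_add, TensorProduct.add_tmul, TensorProduct.tmul_smul,
        ← TensorProduct.smul_tmul', TensorProduct.tmul_sub, TensorProduct.sub_tmul, smul_sub]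
      abel)

/-- The counit on the generators. -/
def counitGen : Gen → ℂ
  | .E => 0
  | .F => 0
  | .K => 1
  | .Kinv => 1

/-- `ε E = ε F = 0`, `ε K = 1`. -/
def counit : Uq q →ₐ[ℂ] ℂ :=
  lift q counitGen (by simp [counitGen]) (by simp [counitGen]) (by simp [counitGen])
    (by simp [counitGen]) (by simp [counitGen])

@[simp]
theorem comul_gen (g : Gen) : comul q (gen q g) = comulGen q g := lift_gen ..

@[simp]
theorem counit_gen (g : Gen) : counit q (gen q g) = counitGen g := lift_gen ..

instance bialgebra : Bialgebra ℂ (Uq q) :=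
  Bialgebra.ofAlgHom (comul q) (counit q)
    (by
      refine hom_ext q fun g => ?_
      cases g <;> simp [comulGen, TensorProduct.add_tmul, TensorProduct.tmul_add,
        Algebra.TensorProduct.one_def, add_assoc])
    (by
      refine hom_ext q fun g => ?_
      cases g <;> simp [comulGen, counitGen])
    (by
      refine hom_ext q fun g => ?_
      cases g <;> simp [comulGen, counitGen])

end Uq

/-- The quantum integer `[z] = (q^z - q^{-z}) / (q - q^{-1})`. -/
def qInt (q : ℂˣ) (z : ℤ) : ℂ := ((q : ℂ) ^ z - (q : ℂ) ^ (-z)) / ((q : ℂ) - (q : ℂ)⁻¹)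

variable (q : ℂˣ) (ε : ℤˣ) (n : ℕ)

/-- `E v_i = ε [n - i + 1] v_{i-1}` -/
def qE : Module.End ℂ (Fin (n + 1) → ℂ) :=
  weighted n (-1) fun i => ((ε : ℤ) : ℂ) * qInt q (n - i + 1)

/-- `F v_i = [i + 1] v_{i+1}` -/
def qF : Module.End ℂ (Fin (n + 1) → ℂ) := weighted n 1 fun i => qInt q (i + 1)

/-- `K v_i = ε q^{n-2i} v_i` -/
def qK : Module.End ℂ (Fin (n + 1) → ℂ) :=
  weighted n 0 fun i => ((ε : ℤ) : ℂ) * (q : ℂ) ^ ((n : ℤ) - 2 * i)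

/-- `K⁻¹ v_i = ε q^{-(n-2i)} v_i` -/
def qKinv : Module.End ℂ (Fin (n + 1) → ℂ) :=
  weighted n 0 fun i => ((ε : ℤ) : ℂ) * (q : ℂ) ^ (-((n : ℤ) - 2 * i))

/-- The action of the generators on `V_{ε,n}`. -/
def qOp : Gen → Module.End ℂ (Fin (n + 1) → ℂ)
  | .E => qE q ε n
  | .F => qF q n
  | .K => qK q ε n
  | .Kinv => qKinv q ε n

theorem qInt_zero : qInt q 0 = 0 := by simp [qInt]

theorem qE_vec (i : ℤ) : qE q ε n (vec n i) =
    (((ε : ℤ) : ℂ) * qInt q (n - i + 1)) • vec n (i - 1) := by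
  have := weighted_vec n (-1) (fun i => ((ε : ℤ) : ℂ) * qInt q (n - i + 1)) i (fun h => by
    by_cases hi : i = n + 1
    · left; rw [hi]; simp [qInt_zero]
    · right; omega)
  exact this

theorem qF_vec (i : ℤ) : qF q n (vec n i) = qInt q (i + 1) • vec n (i + 1) := by
  have := weighted_vec n 1 (fun i => qInt q (i + 1)) i (fun h => by
    by_cases hi : i = -1
    · left; rw [hi]; simp [qInt_zero]
    · right; omega)
  exact this

theorem qK_vec (i : ℤ) : qK q ε n (vec n i) =
    (((ε : ℤ) : ℂ) * (q : ℂ) ^ ((n : ℤ) - 2 * i)) • vec n i := by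
  unfold qK
  rw [weighted_zero_vec]

theorem qKinv_vec (i : ℤ) : qKinv q ε n (vec n i) =
    (((ε : ℤ) : ℂ) * (q : ℂ) ^ (-((n : ℤ) - 2 * i))) • vec n i := by
  unfold qKinv
  rw [weighted_zero_vec]

theorem qInt_identity (n i : ℤ) :
    qInt q (i + 1) * qInt q (n - i) - qInt q (n - i + 1) * qInt q i =
      ((q : ℂ) - (q : ℂ)⁻¹)⁻¹ * ((q : ℂ) ^ (n - 2 * i) - (q : ℂ) ^ (-(n - 2 * i))) := by
  by_cases hc : (q : ℂ) - (q : ℂ)⁻¹ = 0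
  · simp [qInt, hc]
  have hq : (q : ℂ) ≠ 0 := q.ne_zero
  have hx : (q : ℂ) ^ i ≠ 0 := zpow_ne_zero _ hq
  have hy : (q : ℂ) ^ n ≠ 0 := zpow_ne_zero _ hq
  have h2 : (q : ℂ) ^ (2 * i) = (q : ℂ) ^ i * (q : ℂ) ^ i := by rw [two_mul, zpow_add₀ hq]
  have key : ((q : ℂ) ^ (i + 1) - (q : ℂ) ^ (-(i + 1))) * ((q : ℂ) ^ (n - i) - (q : ℂ) ^ (-(n - i)))
      - ((q : ℂ) ^ (n - i + 1) - (q : ℂ) ^ (-(n - i + 1))) * ((q : ℂ) ^ i - (q : ℂ) ^ (-i)) =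
      ((q : ℂ) - (q : ℂ)⁻¹) * ((q : ℂ) ^ (n - 2 * i) - (q : ℂ) ^ (-(n - 2 * i))) := by
    simp only [zpow_neg, zpow_add₀ hq, zpow_sub₀ hq, h2, zpow_one]
    generalize (q : ℂ) ^ i = x at *
    generalize (q : ℂ) ^ n = y at *
    generalize (q : ℂ) = a at *
    field_simp
    ring
  have hc' := mul_inv_cancel₀ hc
  simp only [qInt, div_eq_mul_inv]
  linear_combination ((q : ℂ) - (q : ℂ)⁻¹)⁻¹ ^ 2 * key +
    ((q : ℂ) - (q : ℂ)⁻¹)⁻¹ * ((q : ℂ) ^ (n - 2 * i) - (q : ℂ) ^ (-(n - 2 * i))) * hc'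

theorem sign_sq : ((ε : ℤ) : ℂ) * ((ε : ℤ) : ℂ) = 1 := by
  have h : (ε : ℤ) * (ε : ℤ) = 1 := congrArg Units.val (Int.units_mul_self ε)
  exact_mod_cast h

/-- The representation of `U_q(sl₂(ℂ))` on `V_{ε,n}`. -/
def qRep : Uq q →ₐ[ℂ] Module.End ℂ (Fin (n + 1) → ℂ) :=
  Uq.lift q (qOp q ε n)
    (by
      refine end_ext fun i _ _ => ?_
      have hq := q.ne_zero
      simp only [qOp, Module.End.mul_apply, qK_vec, qKinv_vec, map_smul, smul_smul,
        Module.End.one_apply]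
      rw [mul_mul_mul_comm, sign_sq, ← zpow_add₀ hq]
      simp)
    (by
      refine end_ext fun i _ _ => ?_
      have hq := q.ne_zero
      simp only [qOp, Module.End.mul_apply, qK_vec, qKinv_vec, map_smul, smul_smul,
        Module.End.one_apply]
      rw [mul_mul_mul_comm, sign_sq, ← zpow_add₀ hq]
      simp)
    (by
      refine end_ext fun i _ _ => ?_
      have hq := q.ne_zero
      simp only [qOp, Module.End.mul_apply, LinearMap.smul_apply, qK_vec, qE_vec, map_smul,
        smul_smul]
      congr 1
      rw [show (n : ℤ) - 2 * (i - 1) = 2 + (n - 2 * i) by ring, zpow_add₀ hq]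
      simp only [zpow_ofNat]
      ring)
    (by
      refine end_ext fun i _ _ => ?_
      have hq := q.ne_zero
      simp only [qOp, Module.End.mul_apply, LinearMap.smul_apply, qK_vec, qF_vec, map_smul,
        smul_smul]
      congr 1
      rw [show (n : ℤ) - 2 * (i + 1) = -2 + (n - 2 * i) by ring, zpow_add₀ hq]
      ring)
    (by
      refine end_ext fun i _ _ => ?_
      have hq := q.ne_zero
      simp only [qOp, Module.End.mul_apply, LinearMap.smul_apply, LinearMap.sub_apply, qK_vec,
        qKinv_vec, qE_vec, qF_vec, map_smul, smul_smul, add_sub_cancel_right,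
        sub_add_cancel, ← sub_smul]
      congr 1
      have h := qInt_identity q n i
      rw [show (n : ℤ) - (i + 1) + 1 = n - i by ring]
      linear_combination ((ε : ℤ) : ℂ) * h)

theorem qRep_gen (g : Gen) : qRep q ε n (Uq.gen q g) = qOp q ε n g := by
  unfold qRep
  rw [Uq.lift_gen]

/-- The `U_q(sl₂(ℂ))`-module `V_{ε,n}`, of dimension `n + 1`, for `ε = ±1` and `q ≠ ±1`. -/
def Vq : FDMod ℂ (Uq q) where
  carrier := Fin (n + 1) → ℂ
  act := qRep q ε n

end Quantum

end ClebschGordan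

end

open ClebschGordan

/-!
The Clebsch-Gordan formulas for `U(sl₂)` and for `U_q(sl₂)` have the same proof. In both cases the
modules at hand are strings: a basis `v_0, …, v_p` which `E` moves down, `F` moves up and `H` (or `K`)
scales by pairwise distinct weights, where the coefficients of `E` and `F` vanish only at the ends
(`IsString`; for `U_q(sl₂)` this is where `q` is not a root of unity). A highest weight vector `w` of a
finite-dimensional module generates such a string: the vectors `F^i w` have distinct weights, so one of
them vanishes, and the commutator of `E` and `F` forces the first that does to be `F^{p+1} w`
(`IsString.exists_hom`). The tensor product of the modules of highest weights `n` and `m` contains, for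
each `l ≤ min n m`, a highest weight vector among the combinations of the `v_i ⊗ v_{l-i}`, obtained by
solving a two-term recursion (`exists_highest_weight`). The resulting morphism from the direct sum of
strings is injective, because `E` is nilpotent and on the kernel of `E` the morphism sends a basis to
eigenvectors with distinct eigenvalues; it is bijective because the dimensions agree
(`iso_directSum_of_highest_weight`).

In the Grothendieck ring the formula says that the classes of the strings span a subring with the
required multiplication. They are linearly independent over `ℤ` because the dimension of the space of
highest weight vectors of a given weight is additive on direct sums and separates them
(`linearIndependent_cls`), which gives the axiomatisation (`exists_subring_tensorAxioms`). Conversely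
the axioms determine the products: the recursion `[w + 2] = [1][w + 1] - [w]` makes the symbols
commute, and then an induction on the smaller factor gives the fusion rule (`symbol_mul`).
-/

noncomputable section

open scoped TensorProduct

universe u v

namespace ClebschGordan

/-! ### String modules and highest weight vectors -/

/-- The operators `E`, `F`, `H` act on the space with basis `v_0, …, v_p` by
`E v_i = a_i v_{i-1}`, `F v_i = b_i v_{i+1}`, `H v_i = c_i v_i`. The coefficients are indexed by `ℤ`,
also where `v_i = 0`: the only zero of `a` is `p + 1`, the only zero of `b` is `-1`, and the `c_i` are
pairwise distinct. -/
structure IsString (p : ℕ) (E F H : Module.End ℂ (Fin (p + 1) → ℂ)) (a b c : ℤ → ℂ) : Prop where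
  E_vec : ∀ i, E (vec p i) = a i • vec p (i - 1)
  F_vec : ∀ i, F (vec p i) = b i • vec p (i + 1)
  H_vec : ∀ i, H (vec p i) = c i • vec p i
  a_eq_zero_iff : ∀ i, a i = 0 ↔ i = p + 1
  b_eq_zero_iff : ∀ i, b i = 0 ↔ i = -1
  c_injective : Function.Injective c

theorem sum_smul_vec {p : ℕ} (x : Fin (p + 1) → ℂ) : ∑ i, x i • vec p ((i : ℕ) : ℤ) = x := by
  simp_rw [vec_natCast]
  ext j
  simp [Finset.sum_apply, Pi.single_apply]

theorem vec_ne_zero (p : ℕ) (i : ℕ) (hi : i ≤ p) : vec p i ≠ 0 := fun h => by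
  have := congrFun h ⟨i, by omega⟩
  simp [vec] at this

namespace IsString

variable {p : ℕ} {E F H : Module.End ℂ (Fin (p + 1) → ℂ)} {a b c : ℤ → ℂ}

theorem E_pow_vec (hs : IsString p E F H a b c) (k : ℕ) (i : ℤ) :
    ∃ t : ℂ, (E ^ k) (vec p i) = t • vec p (i - k) := by
  induction k with
  | zero => exact ⟨1, by simp⟩
  | succ k ih =>
    obtain ⟨t, ht⟩ := ih
    refine ⟨t * a (i - k), ?_⟩
    rw [pow_succ', Module.End.mul_apply, ht, map_smul, hs.E_vec, smul_smul]
    congr 2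
    push_cast
    ring

theorem E_pow_eq_zero (hs : IsString p E F H a b c) {k : ℕ} (hk : p < k) : E ^ k = 0 := by
  refine end_ext fun i h0 h1 => ?_
  obtain ⟨t, ht⟩ := hs.E_pow_vec k i
  rw [ht, vec_eq_zero p _ (by omega), smul_zero, LinearMap.zero_apply]

theorem eq_smul_vec_zero (hs : IsString p E F H a b c) {x : Fin (p + 1) → ℂ} (hx : E x = 0) :
    x = x 0 • vec p 0 := by
  have hsucc : ∀ j : ℕ, ∀ hj : j + 1 < p + 1, x ⟨j + 1, hj⟩ = 0 := by
    intro j hj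
    have h := congrFun hx ⟨j, by omega⟩
    rw [← sum_smul_vec x, map_sum, Finset.sum_apply, Finset.sum_eq_single ⟨j + 1, hj⟩] at h
    · have ha : a ((j + 1 : ℕ) : ℤ) ≠ 0 := fun h' => by
        have := (hs.a_eq_zero_iff _).1 h'
        omega
      rw [Pi.zero_apply, map_smul, hs.E_vec] at h
      have hv : vec p (((j + 1 : ℕ) : ℤ) - 1) ⟨j, by omega⟩ = 1 := by simp [vec]
      rw [Pi.smul_apply, Pi.smul_apply, hv, smul_eq_mul, smul_eq_mul, mul_one] at h
      exact (mul_eq_zero.1 h).resolve_right ha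
    · intro i _ hi
      have : (i : ℕ) ≠ j + 1 := fun h' => hi (Fin.ext h')
      have h2 : ¬ ((j : ℤ) = (i : ℕ) - 1) := by omega
      rw [map_smul, hs.E_vec]
      simp [vec, h2]
    · simp
  ext j
  obtain ⟨j, hj⟩ := j
  cases j with
  | zero => simp [vec]
  | succ j =>
    rw [hsucc j hj]
    simp [vec]
    intro h
    omega

/-- The image of the basis `v_0, v_1, …` of a string module under the morphism that sends `v_0` to
`w`. -/
def descend {M : Type*} [AddCommGroup M] [Module ℂ M] (f : Module.End ℂ M) (b : ℤ → ℂ) (w : M) :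
    ℕ → M
  | 0 => w
  | i + 1 => (b i)⁻¹ • f (descend f b w i)

variable {M : Type*} [AddCommGroup M] [Module ℂ M] {e f h : Module.End ℂ M}

section Descend

variable (hs : IsString p E F H a b c) {w : M} (hew : e w = 0) (hhw : h w = c 0 • w)
  (hf : ∀ (i : ℕ) x, h x = c i • x → h (f x) = c (i + 1) • f x)
  (hef : ∀ (i : ℕ) x, h x = c i • x →
    e (f x) - f (e x) = (a (i + 1) * b i - b (i - 1) * a i) • x)

include hs in
theorem f_descend (i : ℕ) : f (descend f b w i) = b i • descend f b w (i + 1) := by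
  have hb : b i ≠ 0 := fun h' => by
    have := (hs.b_eq_zero_iff _).1 h'
    omega
  rw [descend, smul_inv_smul₀ hb]

include hhw hf in
theorem h_descend (i : ℕ) : h (descend f b w i) = c i • descend f b w i := by
  induction i with
  | zero => exact hhw
  | succ i ih =>
    rw [descend, map_smul, hf i _ ih, smul_comm]
    push_cast
    rfl

include hs hew hhw hf hef in
theorem e_descend (i : ℕ) :
    e (descend f b w (i + 1)) = a (i + 1) • descend f b w i := by
  induction i with
  | zero =>
    have h1 := hef 0 w (by simpa using hhw)
    have hb : b 0 ≠ 0 := fun h' => by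
      have := (hs.b_eq_zero_iff _).1 h'
      omega
    have hb' : b (-1) = 0 := (hs.b_eq_zero_iff _).2 rfl
    rw [hew, map_zero, sub_zero] at h1
    change e ((b (0 : ℕ))⁻¹ • f w) = a ((0 : ℕ) + 1) • w
    rw [Nat.cast_zero] at h1 ⊢
    rw [map_smul, h1, smul_smul]
    congr 1
    simp only [zero_sub, hb', zero_mul, sub_zero]
    field_simp
  | succ i ih =>
    have h1 := hef (i + 1) (descend f b w (i + 1)) (h_descend hhw hf (i + 1))
    have hb : b ((i + 1 : ℕ) : ℤ) ≠ 0 := fun h' => by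
      have := (hs.b_eq_zero_iff _).1 h'
      omega
    rw [ih, map_smul, f_descend hs i, smul_smul, sub_eq_iff_eq_add, ← add_smul] at h1
    change e ((b (i + 1 : ℕ))⁻¹ • f (descend f b w (i + 1))) = _
    rw [map_smul, h1, smul_smul]
    congr 1
    push_cast at hb ⊢
    rw [show (i : ℤ) + 1 - 1 = i by ring]
    field_simp
    ring

variable [Module.Finite ℂ M]

include hs hhw hf in
/-- The vectors `w, F w, F² w, …` have distinct weights, so in finite dimension they vanish from
some point on. -/
theorem exists_descend_eq_zero : ∃ i, descend f b w i = 0 := by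
  by_contra! hne
  have hfin := Module.End.finite_hasEigenvalue (f := h)
  refine Set.infinite_of_injective_forall_mem (f := fun i : ℕ => c i)
    (fun i j hij => by exact_mod_cast hs.c_injective hij) (fun i => ?_) hfin
  exact Module.End.hasEigenvalue_of_hasEigenvector (x := descend f b w i)
    (Module.End.hasEigenvector_iff.2
      ⟨Module.End.mem_eigenspace_iff.2 (h_descend hhw hf i), hne i⟩)

include hs hew hhw hf hef in
theorem descend_eq_zero (hw : w ≠ 0) : descend f b w (p + 1) = 0 := by
  classical
  have hex := exists_descend_eq_zero hs hhw hf
  obtain ⟨N, hN⟩ : ∃ N, Nat.find hex = N := ⟨_, rfl⟩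
  have h0 := Nat.find_spec hex
  rw [hN] at h0
  cases N with
  | zero => exact absurd h0 hw
  | succ N =>
    have h1 := e_descend hs hew hhw hf hef N
    rw [h0, map_zero, eq_comm, smul_eq_zero] at h1
    -- the first index at which the vectors vanish is a zero of `a`, hence it is `p + 1`
    rcases h1 with h1 | h1
    · have := (hs.a_eq_zero_iff _).1 h1
      obtain rfl : N = p := by omega
      exact h0
    · exact absurd h1 (Nat.find_min hex (by omega))

include hs hew hhw hf hef in
/-- A highest weight vector `w` of the weight of `v_0` is the image of `v_0` under a morphism of
modules. -/
theorem exists_hom (hw : w ≠ 0) : ∃ T : (Fin (p + 1) → ℂ) →ₗ[ℂ] M, T (vec p 0) = w ∧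
    (∀ x, T (E x) = e (T x)) ∧ (∀ x, T (F x) = f (T x)) ∧ ∀ x, T (H x) = h (T x) := by
  let T : (Fin (p + 1) → ℂ) →ₗ[ℂ] M :=
    (Pi.basisFun ℂ (Fin (p + 1))).constr ℂ fun i => descend f b w i
  have hT : ∀ i : ℕ, i ≤ p + 1 → T (vec p i) = descend f b w i := by
    intro i hi
    rcases Nat.lt_or_ge i (p + 1) with hi' | hi'
    · have h1 := (Pi.basisFun ℂ (Fin (p + 1))).constr_basis ℂ
        (fun i => descend f b w i) ⟨i, hi'⟩
      rw [Pi.basisFun_apply, ← vec_natCast] at h1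
      exact h1
    · obtain rfl : i = p + 1 := by omega
      rw [descend_eq_zero hs hew hhw hf hef hw, vec_eq_zero p _ (by omega), map_zero]
  have hext : ∀ {g g' : (Fin (p + 1) → ℂ) →ₗ[ℂ] M},
      (∀ i : ℕ, i ≤ p → g (vec p i) = g' (vec p i)) → ∀ x, g x = g' x := by
    intro g g' hg
    refine LinearMap.congr_fun ((Pi.basisFun ℂ (Fin (p + 1))).ext fun i => ?_)
    rw [Pi.basisFun_apply, ← vec_natCast]
    exact hg _ (by have := i.2; omega)
  refine ⟨T, by simpa [descend] using hT 0 (by omega), ?_, ?_, ?_⟩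
  · refine hext (g := T ∘ₗ E) (g' := e ∘ₗ T) fun i hi => ?_
    rw [LinearMap.comp_apply, LinearMap.comp_apply, hs.E_vec, map_smul, hT i (by omega)]
    cases i with
    | zero => rw [vec_eq_zero p _ (by simp), map_zero, smul_zero, descend, hew]
    | succ i =>
      rw [e_descend hs hew hhw hf hef]
      push_cast
      rw [add_sub_cancel_right, hT i (by omega)]
  · refine hext (g := T ∘ₗ F) (g' := f ∘ₗ T) fun i hi => ?_
    rw [LinearMap.comp_apply, LinearMap.comp_apply, hs.F_vec, map_smul, hT i (by omega),
      f_descend hs]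
    have := hT (i + 1) (by omega)
    push_cast at this
    rw [this]
  · refine hext (g := T ∘ₗ H) (g' := h ∘ₗ T) fun i hi => ?_
    rw [LinearMap.comp_apply, LinearMap.comp_apply, hs.H_vec, map_smul, hT i (by omega),
      h_descend hhw hf]

end Descend

end IsString

/-- A linear map that intertwines a nilpotent operator is injective once it is injective on the
kernel of that operator. -/
theorem injective_of_injective_on_ker {A B : Type*} [AddCommGroup A] [Module ℂ A]
    [AddCommGroup B] [Module ℂ B] (T : A →ₗ[ℂ] B) (e : Module.End ℂ A) (e' : Module.End ℂ B)
    (hT : ∀ x, T (e x) = e' (T x)) (hker : ∀ x, e x = 0 → T x = 0 → x = 0) {N : ℕ}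
    (hN : e ^ N = 0) : Function.Injective T := by
  have key : ∀ k : ℕ, ∀ x, (e ^ k) x = 0 → T x = 0 → x = 0 := by
    intro k
    induction k with
    | zero => intro x hx _; simpa using hx
    | succ k ih =>
      intro x hx hTx
      refine hker x (ih (e x) ?_ ?_) hTx
      · rwa [pow_succ, Module.End.mul_apply] at hx
      · rw [hT, hTx, map_zero]
  refine (injective_iff_map_eq_zero T).2 fun x hx => key N x (by rw [hN]; rfl) hx

section Decomposition

variable {Λ : Type v} [Ring Λ] [Algebra ℂ Λ]

theorem directSum_act_apply {n : ℕ} (M : Fin n → FDMod ℂ Λ) (t : Λ) (x : ∀ l, (M l).carrier)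
    (l : Fin n) : (FDMod.directSum M).act t x l = (M l).act t (x l) := rfl

/-- A module which contains highest weight vectors of the weights of finitely many string modules,
these weights being distinct, and which has the dimension of the direct sum of these string modules,
is isomorphic to that direct sum. The hypothesis `hgen` says that `e`, `f` and `h` control
equivariance. -/
theorem iso_directSum_of_highest_weight (e f h : Λ)
    (hgen : ∀ {M N : FDMod ℂ Λ} (T : M.carrier →ₗ[ℂ] N.carrier),
      (∀ x, T (M.act e x) = N.act e (T x)) → (∀ x, T (M.act f x) = N.act f (T x)) →
      (∀ x, T (M.act h x) = N.act h (T x)) → ∀ t x, T (M.act t x) = N.act t (T x))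
    (ρ : ∀ p : ℕ, Λ →ₐ[ℂ] Module.End ℂ (Fin (p + 1) → ℂ)) (a b c : ℕ → ℤ → ℂ)
    (hs : ∀ p, IsString p (ρ p e) (ρ p f) (ρ p h) (a p) (b p) (c p))
    (M : FDMod ℂ Λ)
    (hf : ∀ (p i : ℕ) x, M.act h x = c p i • x →
      M.act h (M.act f x) = c p (i + 1) • M.act f x)
    (hef : ∀ (p i : ℕ) x, M.act h x = c p i • x →
      M.act e (M.act f x) - M.act f (M.act e x) =
        (a p (i + 1) * b p i - b p (i - 1) * a p i) • x)
    {r : ℕ} (p : Fin r → ℕ) (hp : Function.Injective fun l => c (p l) 0)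
    (hw : ∀ l, ∃ w, w ≠ 0 ∧ M.act e w = 0 ∧ M.act h w = c (p l) 0 • w)
    (hdim : Module.finrank ℂ M.carrier = ∑ l, (p l + 1)) :
    M.Iso (FDMod.directSum fun l => ⟨Fin (p l + 1) → ℂ, ρ (p l)⟩) := by
  choose w hw0 hew hhw using hw
  choose T hT0 hTe hTf hTh using fun l =>
    (hs (p l)).exists_hom (hew l) (hhw l) (hf (p l)) (hef (p l)) (hw0 l)
  let D : FDMod ℂ Λ := FDMod.directSum fun l => ⟨Fin (p l + 1) → ℂ, ρ (p l)⟩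
  let S : D.carrier →ₗ[ℂ] M.carrier :=
    LinearMap.lsum ℂ (fun l => Fin (p l + 1) → ℂ) ℂ T
  have hlsum : ∀ x : ∀ l, Fin (p l + 1) → ℂ,
      LinearMap.lsum ℂ (fun l => Fin (p l + 1) → ℂ) ℂ T x = ∑ l, T l (x l) := fun x => by
    rw [LinearMap.lsum_apply, LinearMap.sum_apply]
    rfl
  have hS : ∀ x : D.carrier, S x = ∑ l, T l (x l) := hlsum
  have hSg : ∀ t : Λ, (∀ l x, T l (ρ (p l) t x) = M.act t (T l x)) →
      ∀ x, S (D.act t x) = M.act t (S x) := by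
    intro t ht x
    rw [hS, hS, map_sum]
    exact Finset.sum_congr rfl fun l _ => ht l (x l)
  have hSe := hSg e hTe
  have hact := hgen (M := D) (N := M) S hSe (hSg f hTf) (hSg h hTh)
  have hlin : LinearIndependent ℂ w :=
    Module.End.eigenvectors_linearIndependent' (M.act h) (fun l => c (p l) 0) hp w fun l =>
      Module.End.hasEigenvector_iff.2 ⟨Module.End.mem_eigenspace_iff.2 (hhw l), hw0 l⟩
  have hinj : Function.Injective S := by
    refine injective_of_injective_on_ker S (D.act e) (M.act e) hSe ?_
      (N := ∑ l, (p l + 1)) ?_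
    · intro x hx hSx
      have hx' : ∀ l, x l = x l 0 • vec (p l) 0 := fun l =>
        (hs (p l)).eq_smul_vec_zero (congrFun hx l)
      have hsum : ∑ l, x l 0 • w l = 0 := by
        rw [← hSx, hS]
        refine Finset.sum_congr rfl fun l _ => ?_
        conv_rhs => rw [hx' l]
        rw [map_smul, hT0]
      have hzero := Fintype.linearIndependent_iff.1 hlin _ hsum
      funext l
      rw [hx' l, hzero l, zero_smul]
      rfl
    · rw [← map_pow]
      refine LinearMap.ext fun x => funext fun l => ?_
      refine (directSum_act_apply _ _ x l).trans ?_
      change ρ (p l) (e ^ _) (x l) = 0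
      rw [map_pow, (hs (p l)).E_pow_eq_zero, LinearMap.zero_apply]
      exact Finset.single_le_sum (f := fun l => p l + 1) (fun _ _ => Nat.zero_le _)
        (Finset.mem_univ l)
  have hdimD : Module.finrank ℂ D.carrier = ∑ l, (p l + 1) := by
    change Module.finrank ℂ (∀ l, Fin (p l + 1) → ℂ) = _
    rw [Module.finrank_pi_fintype]
    simp
  exact FDMod.Iso.symm
    ⟨LinearEquiv.ofInjectiveOfFinrankEq S hinj (hdimD.trans hdim.symm), hact⟩

end Decomposition

/-- In a tensor product of two string modules, a grading-lowering operator that acts on both factors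
kills a nonzero combination of the `v_i ⊗ v_{l-i}`, for every `l ≤ min n m`: its coefficients solve
a two-term recursion. -/
theorem exists_highest_weight {n m : ℕ}
    (E H : Module.End ℂ ((Fin (n + 1) → ℂ) ⊗[ℂ] (Fin (m + 1) → ℂ))) (α β : ℤ → ℤ → ℂ) (γ : ℤ → ℂ)
    (hE : ∀ i j, E (vec n i ⊗ₜ vec m j) =
      α i j • vec n (i - 1) ⊗ₜ[ℂ] vec m j + β i j • vec n i ⊗ₜ[ℂ] vec m (j - 1))
    (hH : ∀ i j, H (vec n i ⊗ₜ vec m j) = γ (i + j) • vec n i ⊗ₜ[ℂ] vec m j)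
    (hα : ∀ i j : ℤ, 1 ≤ i → i ≤ n → α i j ≠ 0) {l : ℕ} (hln : l ≤ n) (hlm : l ≤ m) :
    ∃ w, w ≠ 0 ∧ E w = 0 ∧ H w = γ l • w := by
  let s : ℕ → ℂ := fun i =>
    Nat.rec 1 (fun i si => -(si * β i (l - i)) / α (i + 1) (l - (i + 1))) i
  have hs0 : s 0 = 1 := rfl
  have hs : ∀ i : ℕ, i + 1 ≤ l → s (i + 1) * α (i + 1) (l - (i + 1)) = -(s i * β i (l - i)) :=
    fun i hi => div_mul_cancel₀ _ (hα _ _ (by omega) (by omega))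
  refine ⟨∑ i ∈ Finset.range (l + 1), s i • vec n i ⊗ₜ[ℂ] vec m (l - i), ?_, ?_, ?_⟩
  · intro h0
    -- the coefficient of `v_0 ⊗ v_l` is `1`
    let φ : (Fin (n + 1) → ℂ) ⊗[ℂ] (Fin (m + 1) → ℂ) →ₗ[ℂ] ℂ :=
      LinearMap.mul' ℂ ℂ ∘ₗ TensorProduct.map (LinearMap.proj 0) (LinearMap.proj ⟨l, by omega⟩)
    have h1 := congrArg φ h0
    rw [map_sum, Finset.sum_eq_single 0] at h1
    · simp [φ, hs0, vec] at h1
    · intro i _ hi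
      have : ¬ (0 : ℤ) = (i : ℤ) := by omega
      simp [φ, vec, this]
    · simp
  · -- the two halves of `E` telescope
    have hterm : ∀ k : ℕ, k ≤ l →
        E (∑ i ∈ Finset.range (k + 1), s i • vec n i ⊗ₜ[ℂ] vec m (l - i)) =
          (s k * β k (l - k)) • vec n k ⊗ₜ[ℂ] vec m (l - k - 1) := by
      intro k hk
      induction k with
      | zero =>
        have hv : vec n (-1) = 0 := vec_eq_zero n _ (by simp)
        simp [hE, hs0, hv]
      | succ k ih =>
        rw [Finset.sum_range_succ, map_add, ih (by omega), map_smul, hE, smul_add, smul_smul,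
          smul_smul]
        have h1 := hs k hk
        push_cast
        rw [h1, add_sub_cancel_right, show (l : ℤ) - (k + 1) = l - k - 1 by ring, ← add_assoc,
          neg_smul, add_neg_cancel, zero_add]
    rw [hterm l le_rfl, vec_eq_zero m _ (by simp), TensorProduct.tmul_zero, smul_zero]
  · rw [map_sum, Finset.smul_sum]
    refine Finset.sum_congr rfl fun i _ => ?_
    rw [map_smul, hH, smul_comm, add_sub_cancel]

/-! ### Additive functions on the Grothendieck ring -/

section Additive

variable {k : Type u} [Field k] {Λ : Type v} [Ring Λ]

/-- An integer-valued function on modules that is invariant under isomorphism and additive on direct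
sums factors through the Grothendieck ring. -/
theorem exists_additive_hom [Bialgebra k Λ] (φ : FDMod k Λ → ℤ)
    (hiso : ∀ M N : FDMod k Λ, M.Iso N → φ M = φ N)
    (hprod : ∀ M N : FDMod k Λ, φ (M.prod N) = φ M + φ N) :
    ∃ g : GrothendieckRing k Λ →+ ℤ, ∀ M, g M.cls = φ M := by
  let φ' : FreeAbelianGroup (IsoClass k Λ) →+ ℤ :=
    FreeAbelianGroup.lift (Quotient.lift φ hiso)
  have hφ' : ∀ M, φ' (freeClass M) = φ M := fun M => FreeAbelianGroup.lift_apply_of _ _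
  have hker : splitRelations k Λ ≤ φ'.ker := by
    refine (AddSubgroup.closure_le _).2 ?_
    rintro _ ⟨X, Y, rfl⟩
    change φ' _ = 0
    rw [map_sub, map_sub, hφ', hφ', hφ', hprod]
    ring
  have hle : (splitIdeal k Λ).ringCon.toAddCon ≤ AddCon.ker φ' := by
    intro x y hxy
    have h1 : x - y ∈ splitIdeal k Λ := ((splitIdeal k Λ).rel_iff x y).1 hxy
    have h2 : φ' (x - y) = 0 := hker ((TwoSidedIdeal.mem_mk' _ _ _ _ _ _ _).1 h1)
    rw [map_sub, sub_eq_zero] at h2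
    exact h2
  let g := AddCon.lift (splitIdeal k Λ).ringCon.toAddCon φ' hle
  exact ⟨AddMonoidHom.mk' (fun x : GrothendieckRing k Λ => g x) (fun x y => map_add g x y), hφ'⟩

theorem cls_eq_of_iso [Bialgebra k Λ] {M N : FDMod k Λ} (h : M.Iso N) : M.cls = N.cls :=
  congrArg (splitIdeal k Λ).ringCon.mk' (freeClass_eq h)

theorem cls_prod [Bialgebra k Λ] (M N : FDMod k Λ) : (M.prod N).cls = M.cls + N.cls := by
  unfold FDMod.cls
  rw [← map_add]
  refine (RingCon.eq _).2 (((splitIdeal k Λ).rel_iff _ _).2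
    ((TwoSidedIdeal.mem_mk' _ _ _ _ _ _ _).2 (AddSubgroup.subset_closure ⟨M, N, ?_⟩)))
  abel

theorem cls_tensor [Bialgebra k Λ] (M N : FDMod k Λ) :
    (M.tensor N).cls = M.cls * N.cls := by
  unfold FDMod.cls
  rw [← map_mul, freeClass_mul]

theorem directSum_succ_iso [Algebra k Λ] {n : ℕ} (M : Fin (n + 1) → FDMod k Λ) :
    (FDMod.directSum M).Iso ((M 0).prod (FDMod.directSum fun l : Fin n => M l.succ)) :=
  ⟨{ toFun := fun x => (x 0, fun l => x l.succ)
     map_add' := fun _ _ => rfl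
     map_smul' := fun _ _ => rfl
     invFun := fun x => Fin.cons (α := fun l => (M l).carrier) x.1 x.2
     left_inv := fun x => Fin.cons_self_tail x
     right_inv := fun _ => rfl }, fun _ _ => rfl⟩

theorem cls_directSum [Bialgebra k Λ] {n : ℕ} (M : Fin n → FDMod k Λ) :
    (FDMod.directSum M).cls = ∑ l, (M l).cls := by
  induction n with
  | zero =>
    -- the zero module is isomorphic to its own double
    have hZ : (FDMod.directSum M).Iso ((FDMod.directSum M).prod (FDMod.directSum M)) :=
      ⟨{ toFun := fun x => (x, x)
         map_add' := fun _ _ => rfl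
         map_smul' := fun _ _ => rfl
         invFun := fun x => x.1
         left_inv := fun _ => rfl
         right_inv := fun _ => Prod.ext rfl (funext fun l => l.elim0) }, fun _ _ => rfl⟩
    have h := cls_eq_of_iso hZ
    rw [cls_prod] at h
    simpa using h
  | succ n ih =>
    rw [cls_eq_of_iso (directSum_succ_iso M), cls_prod, ih, Fin.sum_univ_succ]

variable [Algebra k Λ]

/-- The space of vectors of weight `μ` for `h` that are killed by `e`. -/
def highestWeightSpace (e h : Λ) (μ : k) (M : FDMod k Λ) : Submodule k M.carrier :=
  LinearMap.ker (M.act e) ⊓ Module.End.eigenspace (M.act h) μ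

theorem mem_highestWeightSpace {e h : Λ} {μ : k} {M : FDMod k Λ} {x : M.carrier} :
    x ∈ highestWeightSpace e h μ M ↔ M.act e x = 0 ∧ M.act h x = μ • x := by
  rw [highestWeightSpace, Submodule.mem_inf, LinearMap.mem_ker, Module.End.mem_eigenspace_iff]

theorem finrank_highestWeightSpace_of_iso (e h : Λ) (μ : k) {M N : FDMod k Λ} (hMN : M.Iso N) :
    Module.finrank k (highestWeightSpace e h μ M) =
      Module.finrank k (highestWeightSpace e h μ N) := by
  obtain ⟨φ, hφ⟩ := hMN
  have : (highestWeightSpace e h μ M).map (φ : M.carrier →ₗ[k] N.carrier) =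
      highestWeightSpace e h μ N := by
    ext y
    rw [Submodule.mem_map_equiv, mem_highestWeightSpace, mem_highestWeightSpace,
      ← φ.injective.eq_iff, hφ, map_zero, ← φ.injective.eq_iff, hφ, map_smul,
      LinearEquiv.apply_symm_apply]
  rw [← this]
  exact (LinearEquiv.finrank_map_eq φ _).symm

theorem finrank_highestWeightSpace_prod (e h : Λ) (μ : k) (M N : FDMod k Λ) :
    Module.finrank k (highestWeightSpace e h μ (M.prod N)) =
      Module.finrank k (highestWeightSpace e h μ M) +
        Module.finrank k (highestWeightSpace e h μ N) := by
  have hmem : ∀ x : M.carrier × N.carrier, x ∈ highestWeightSpace e h μ (M.prod N) ↔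
      x.1 ∈ highestWeightSpace e h μ M ∧ x.2 ∈ highestWeightSpace e h μ N := by
    intro x
    rw [mem_highestWeightSpace, mem_highestWeightSpace]
    refine (mem_highestWeightSpace (M := M.prod N)).trans <| Iff.trans (and_congr (Prod.ext_iff (x := (M.act e x.1, N.act e x.2)) (y := 0))
      (Prod.ext_iff (x := (M.act h x.1, N.act h x.2)) (y := μ • x))) ?_
    tauto
  rw [← Module.finrank_prod]
  exact LinearEquiv.finrank_eq
    { toFun := fun x => (⟨x.1.1, ((hmem x.1).1 x.2).1⟩, ⟨x.1.2, ((hmem x.1).1 x.2).2⟩)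
      map_add' := fun _ _ => rfl
      map_smul' := fun _ _ => rfl
      invFun := fun x => ⟨(x.1.1, x.2.1), (hmem _).2 ⟨x.1.2, x.2.2⟩⟩
      left_inv := fun _ => rfl
      right_inv := fun _ => rfl }

end Additive

section Independence

variable {Λ : Type v} [Ring Λ]

theorem finrank_highestWeightSpace_of_isString [Algebra ℂ Λ] (e f h : Λ) {p : ℕ}
    (ρ : Λ →ₐ[ℂ] Module.End ℂ (Fin (p + 1) → ℂ)) {a b c : ℤ → ℂ}
    (hs : IsString p (ρ e) (ρ f) (ρ h) a b c) (μ : ℂ) :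
    Module.finrank ℂ (highestWeightSpace e h μ ⟨Fin (p + 1) → ℂ, ρ⟩) =
      if c 0 = μ then 1 else 0 := by
  have hv : vec p 0 ≠ 0 := by simpa using vec_ne_zero p 0 (Nat.zero_le _)
  have hE : ρ e (vec p 0) = 0 := by
    rw [hs.E_vec, vec_eq_zero p _ (by simp), smul_zero]
  split_ifs with hμ
  · have : highestWeightSpace e h μ ⟨Fin (p + 1) → ℂ, ρ⟩ = Submodule.span ℂ {vec p 0} := by
      ext x
      rw [mem_highestWeightSpace, Submodule.mem_span_singleton]
      constructor
      · rintro ⟨h1, -⟩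
        exact ⟨x 0, (hs.eq_smul_vec_zero h1).symm⟩
      · rintro ⟨t, rfl⟩
        refine ⟨?_, ?_⟩
        · change ρ e (t • vec p 0) = 0
          rw [map_smul, hE, smul_zero]
        · change ρ h (t • vec p 0) = μ • t • vec p 0
          rw [map_smul, hs.H_vec, hμ, smul_comm]
    rw [this]
    exact finrank_span_singleton hv
  · have : highestWeightSpace e h μ ⟨Fin (p + 1) → ℂ, ρ⟩ = ⊥ := by
      refine (Submodule.eq_bot_iff _).2 fun x hx => ?_
      obtain ⟨h1, h2⟩ := mem_highestWeightSpace.1 hx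
      have hx0 := hs.eq_smul_vec_zero h1
      change ρ h x = μ • x at h2
      rw [hx0, map_smul, hs.H_vec, smul_smul, smul_smul, mul_comm] at h2
      have h3 := smul_left_injective ℂ hv h2
      have h4 : x 0 = 0 := by
        by_contra h4
        exact hμ (mul_right_cancel₀ h4 h3)
      rw [hx0, h4, zero_smul]
    rw [this]
    exact finrank_bot ℂ _

/-- The classes of string modules with distinct highest weights are linearly independent: the
dimension of the space of highest weight vectors of a given weight is additive, and it separates
these classes. -/
theorem linearIndependent_cls [Bialgebra ℂ Λ] (e f h : Λ)
    (ρ : ∀ p : ℕ, Λ →ₐ[ℂ] Module.End ℂ (Fin (p + 1) → ℂ)) (a b c : ℕ → ℤ → ℂ)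
    (hs : ∀ p, IsString p (ρ p e) (ρ p f) (ρ p h) (a p) (b p) (c p))
    (hc : Function.Injective fun p => c p 0) :
    LinearIndependent ℤ fun p => FDMod.cls (⟨Fin (p + 1) → ℂ, ρ p⟩ : FDMod ℂ Λ) := by
  classical
  choose g hg using fun μ : ℂ => exists_additive_hom
    (fun M : FDMod ℂ Λ => (Module.finrank ℂ (highestWeightSpace e h μ M) : ℤ))
    (fun M N hMN => by rw [finrank_highestWeightSpace_of_iso e h μ hMN])
    (fun M N => by rw [finrank_highestWeightSpace_prod]; push_cast; rfl)
  refine linearIndependent_iff'.2 fun s t hsum p hp => ?_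
  have h1 := congrArg (g (c p 0)) hsum
  rw [map_sum, Finset.sum_eq_single_of_mem p hp, map_zsmul, hg,
    finrank_highestWeightSpace_of_isString e f h (ρ p) (hs p), if_pos rfl] at h1
  · simpa using h1
  · intro p' _ hpp
    rw [map_zsmul, hg, finrank_highestWeightSpace_of_isString e f h (ρ p') (hs p'),
      if_neg fun h' => hpp (hc h')]
    simp

end Independence

/-! ### The fusion rule -/

section Fusion

variable {R : Type*} [Ring R] {s : ℤ → R} (hneg : s (-1) = 0) (h0 : s 0 * s 0 = s 0)
  (hl : ∀ w : ℕ, s 1 * s w = s (w + 1) + s (w - 1))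
  (hr : ∀ w : ℕ, s w * s 1 = s (w + 1) + s (w - 1))

include hl hr in
theorem commute_one_symbol (w : ℕ) : Commute (s 1) (s w) := (hl w).trans (hr w).symm

include hl in
theorem symbol_add_two (w : ℕ) : s (w + 2) = s 1 * s (w + 1) - s w := by
  have h := hl (w + 1)
  push_cast at h
  rw [h, show (w : ℤ) + 1 + 1 = w + 2 by ring, add_sub_cancel_right, add_sub_cancel_right]

include hneg h0 hl hr in
theorem symbol_zero_mul (w : ℕ) : s 0 * s w = s w := by
  induction w using Nat.twoStepInduction with
  | zero => exact h0
  | one =>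
    have h := hr 0
    simpa [hneg] using h
  | more w ih1 ih2 =>
    have hc : Commute (s 1) (s 0) := by simpa using commute_one_symbol hl hr 0
    push_cast at ih2 ⊢
    rw [symbol_add_two hl, mul_sub, ih1, ← mul_assoc, ← hc.eq, mul_assoc, ih2]

include hl hr in
theorem commute_symbols (x y : ℕ) : Commute (s x) (s y) := by
  have hone : ∀ y : ℕ, Commute (s 1) (s y) := commute_one_symbol hl hr
  have hzero : ∀ y : ℕ, Commute (s 0) (s y) := by
    intro y
    induction y using Nat.twoStepInduction with
    | zero => exact Commute.refl _
    | one => simpa using (hone 0).symm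
    | more w ih1 ih2 =>
      push_cast at ih2 ⊢
      rw [symbol_add_two hl]
      refine Commute.sub_right (Commute.mul_right ?_ ih2) ih1
      simpa using (hone 0).symm
  induction x using Nat.twoStepInduction with
  | zero => simpa using hzero y
  | one => simpa using hone y
  | more w ih1 ih2 =>
    push_cast at ih2 ⊢
    rw [symbol_add_two hl]
    exact Commute.sub_left (Commute.mul_left (hone y) ih2) ih1

include hneg h0 hl hr in
/-- Multiplying the sum for `x + 1` by `s 1` produces two sums, of which the second cancels against
the product for `x` up to its last term; that term is the last one of the sum for `x + 2`. The case
`x ≤ y` keeps all indices nonnegative. -/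
theorem symbol_mul_of_le (x y : ℕ) (hxy : x ≤ y) :
    s x * s y = ∑ l ∈ Finset.range (x + 1), s (x + y - 2 * l) := by
  induction x using Nat.twoStepInduction with
  | zero => simpa using symbol_zero_mul hneg h0 hl hr y
  | one =>
    rw [Finset.sum_range_succ, Finset.sum_range_one, Nat.cast_one, hl y]
    congr 2 <;> push_cast <;> ring
  | more x ih1 ih2 =>
    have ih1 := ih1 (by omega)
    have ih2 := ih2 (by omega)
    have hterm : ∀ l ∈ Finset.range (x + 2), s 1 * s ((x + 1 : ℕ) + y - 2 * l) =
        s ((x + 2 : ℕ) + y - 2 * l) + s ((x : ℕ) + y - 2 * l) := by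
      intro l hl'
      have hlt := Finset.mem_range.1 hl'
      obtain ⟨w, hw⟩ := Int.eq_ofNat_of_zero_le (a := ((x + 1 : ℕ) : ℤ) + y - 2 * l) (by omega)
      rw [hw, hl w, ← hw]
      congr 2 <;> push_cast <;> ring
    have h2 := symbol_add_two hl x
    push_cast at ih2 hterm ⊢
    rw [h2, sub_mul, mul_assoc, ih1, ih2, Finset.mul_sum, Finset.sum_congr rfl hterm,
      Finset.sum_add_distrib, Finset.sum_range_succ (fun l : ℕ => s ((x : ℤ) + y - 2 * l)) (x + 1),
      Finset.sum_range_succ (fun l : ℕ => s ((x : ℤ) + 2 + y - 2 * l)) (x + 2)]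
    have hlast : (x : ℤ) + y - 2 * ((x + 1 : ℕ) : ℤ) = x + 2 + y - 2 * ((x + 2 : ℕ) : ℤ) := by
      push_cast
      ring
    rw [hlast]
    abel

include hneg h0 hl hr in
theorem symbol_mul (x y : ℕ) :
    s x * s y = ∑ l ∈ Finset.range (min x y + 1), s (x + y - 2 * l) := by
  rcases le_total x y with hxy | hxy
  · rw [min_eq_left hxy, symbol_mul_of_le hneg h0 hl hr x y hxy]
  · rw [min_eq_right hxy, (commute_symbols hl hr x y).eq,
      symbol_mul_of_le hneg h0 hl hr y x hxy]
    simp only [add_comm]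

end Fusion

theorem sym_natCast {R : Type*} [Ring R] {I : Type} (b : Module.Basis (I × J ⊤) ℤ R) (i : I)
    (w : ℕ) : sym b i w = b (i, ⟨w, ENat.natCast_lt_top w⟩) := by
  unfold sym
  rw [dif_pos ⟨Int.natCast_nonneg w, ENat.natCast_lt_top _⟩]
  rfl

theorem sym_of_neg {R : Type*} [Ring R] {I : Type} {m : ℕ∞} (b : Module.Basis (I × J m) ℤ R)
    (i : I) {w : ℤ} (hw : w < 0) : sym b i w = 0 :=
  dif_neg fun h => absurd h.1 (by omega)

theorem sym_mul_sym {R : Type*} [Ring R] {b : Module.Basis (ZMod 1 × J ⊤) ℤ R}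
    (hb : TensorAxioms b) (x y : ℕ) : sym b 0 (x : ℤ) * sym b 0 (y : ℤ) =
      ∑ l ∈ Finset.range (min x y + 1), sym b 0 ((x : ℤ) + (y : ℤ) - 2 * (l : ℤ)) := by
  refine symbol_mul (s := sym b 0) (sym_of_neg b 0 (by norm_num)) ?_ (fun w => ?_) (fun w => ?_) x y
  · simpa using hb.zero_mul_zero 0 0
  · simpa [Subsingleton.elim (1 : ZMod 1) 0] using hb.one_mul 0 w (ENat.natCast_lt_top _)
  · simpa [Subsingleton.elim (1 : ZMod 1) 0] using hb.mul_one 0 w (ENat.natCast_lt_top _)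

/-- Linearly independent elements `x_0 = 1, x_1, …` of a ring that multiply by the Clebsch-Gordan
rule are a basis of a subring which satisfies the axiomatisation with `I = {0}` and `m = ∞`. -/
theorem exists_subring_tensorAxioms {K : Type*} [Ring K] (x : ℕ → K)
    (hlin : LinearIndependent ℤ x) (hone : x 0 = 1)
    (hmul : ∀ n m, x n * x m = ∑ l : Fin (min n m + 1), x (n + m - 2 * (l : ℕ))) :
    ∃ (S : Subring K) (b : Module.Basis (ZMod 1 × J ⊤) ℤ S),
      (∀ n : ℕ, ((sym b 0 (n : ℤ) : S) : K) = x n) ∧ TensorAxioms b := by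
  let P : Submodule ℤ K := Submodule.span ℤ (Set.range x)
  have hx : ∀ n, x n ∈ P := fun n => Submodule.subset_span ⟨n, rfl⟩
  have hPmul : ∀ u ∈ P, ∀ v ∈ P, u * v ∈ P := by
    intro u hu v hv
    refine Submodule.span_induction₂ (p := fun u v _ _ => u * v ∈ P) ?_ ?_ ?_ ?_ ?_ ?_ ?_ hu hv
    · rintro _ _ ⟨n, rfl⟩ ⟨m, rfl⟩
      rw [hmul]
      exact Submodule.sum_mem _ fun l _ => hx _
    · intro y _
      rw [zero_mul]
      exact zero_mem _
    · intro y _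
      rw [mul_zero]
      exact zero_mem _
    · intro u v w _ _ _ h1 h2
      rw [add_mul]
      exact add_mem h1 h2
    · intro u v w _ _ _ h1 h2
      rw [mul_add]
      exact add_mem h1 h2
    · intro r u v _ _ h1
      rw [smul_mul_assoc]
      exact P.smul_mem r h1
    · intro r u v _ _ h1
      rw [mul_smul_comm]
      exact P.smul_mem r h1
  let S : Subring K :=
    { P.toAddSubgroup with
      mul_mem' := fun {u v} hu hv => hPmul u hu v hv
      one_mem' := by
        have := hx 0
        rwa [hone] at this }
  let toS : P ≃ₗ[ℤ] S :=
    { toFun := fun u => ⟨u.1, u.2⟩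
      map_add' := fun _ _ => rfl
      map_smul' := fun _ _ => rfl
      invFun := fun u => ⟨u.1, u.2⟩
      left_inv := fun _ => rfl
      right_inv := fun _ => rfl }
  let idx : ℕ ≃ ZMod 1 × J ⊤ :=
    { toFun := fun n => (0, ⟨n, ENat.natCast_lt_top n⟩)
      invFun := fun p => p.2.1
      left_inv := fun _ => rfl
      right_inv := fun p => Prod.ext (Subsingleton.elim _ _) rfl }
  let b : Module.Basis (ZMod 1 × J ⊤) ℤ S := ((Module.Basis.span hlin).map toS).reindex idx
  have hb : ∀ (i : ZMod 1) (n : ℕ), ((sym b i (n : ℤ) : S) : K) = x n := by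
    intro i n
    obtain rfl : i = 0 := Subsingleton.elim _ _
    rw [sym_natCast]
    change ((((Module.Basis.span hlin).map toS).reindex idx (idx n) : S) : K) = x n
    rw [Module.Basis.reindex_apply, Equiv.symm_apply_apply, Module.Basis.map_apply]
    exact congrArg Subtype.val (Module.Basis.span_apply hlin n)
  have hone_mul : ∀ w : ℕ, ∀ i j k l : ZMod 1, sym b i 1 * sym b j (w : ℤ) =
      sym b k ((w : ℤ) + 1) + sym b l ((w : ℤ) - 1) ∧ sym b j (w : ℤ) * sym b i 1 =
      sym b k ((w : ℤ) + 1) + sym b l ((w : ℤ) - 1) := by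
    intro w i j k l
    have h1 : ((sym b i 1 : S) : K) = x 1 := by simpa using hb i 1
    have h2 : ((sym b k ((w : ℤ) + 1) : S) : K) = x (w + 1) := by
      simpa using hb k (w + 1)
    cases w with
    | zero =>
      have h3 : sym b l (((0 : ℕ) : ℤ) - 1) = 0 := sym_of_neg b l (by norm_num)
      rw [h3, add_zero]
      constructor
      · refine Subtype.ext ?_
        rw [Subring.coe_mul, h1, hb, hone, mul_one, h2]
      · refine Subtype.ext ?_
        rw [Subring.coe_mul, h1, hb, hone, one_mul, h2]
    | succ w =>
      have h3 : ((sym b l (((w + 1 : ℕ) : ℤ) - 1) : S) : K) = x w := by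
        simpa using hb l w
      have hmul' : ∀ n m p q r : ℕ, min n m = 1 → n + m = p → p = q → p - 2 = r →
          x n * x m = x q + x r := by
        rintro n m _ _ _ hmin rfl rfl rfl
        rw [hmul, Fin.sum_univ_eq_sum_range (fun l => x (n + m - 2 * l)), hmin,
          Finset.sum_range_succ, Finset.sum_range_one, mul_zero, Nat.sub_zero, mul_one]
      constructor
      · refine Subtype.ext ?_
        rw [Subring.coe_mul, Subring.coe_add, h1, hb, h2, h3]
        exact hmul' _ _ _ _ _ (by omega) rfl (by omega) (by omega)
      · refine Subtype.ext ?_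
        rw [Subring.coe_mul, Subring.coe_add, h1, hb, h2, h3]
        exact hmul' _ _ _ _ _ (by omega) rfl (by omega) (by omega)
  refine ⟨S, b, hb 0, ⟨fun i j => ?_, fun j w _ => (hone_mul w _ _ _ _).1,
    fun j w _ => (hone_mul w _ _ _ _).2, fun j w hw => ?_, fun j w hw => ?_⟩⟩
  · have h : ∀ i : ZMod 1, ((sym b i 0 : S) : K) = x 0 := fun i => by simpa using hb i 0
    refine Subtype.ext ?_
    rw [Subring.coe_mul, h, h, h, hone, one_mul]
  · exact absurd hw (ENat.natCast_ne_top _)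
  · exact absurd hw (ENat.natCast_ne_top _)

/-! ### Equivariance, gradings and dimensions -/

section Equivariance

variable {Λ : Type v} [Ring Λ] [Algebra ℂ Λ]

/-- The elements of the algebra with whose action a linear map commutes. -/
def intertwined {M N : FDMod ℂ Λ} (T : M.carrier →ₗ[ℂ] N.carrier) : Subalgebra ℂ Λ where
  carrier := {t | ∀ x, T (M.act t x) = N.act t (T x)}
  mul_mem' := fun {s t} hs ht x => by
    rw [map_mul, map_mul, Module.End.mul_apply, Module.End.mul_apply, hs, ht]
  add_mem' := fun {s t} hs ht x => by
    rw [map_add, map_add, LinearMap.add_apply, LinearMap.add_apply, map_add, hs, ht]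
  algebraMap_mem' := fun r x => by
    rw [AlgHom.commutes, AlgHom.commutes, Module.algebraMap_end_apply,
      Module.algebraMap_end_apply, map_smul]

theorem mem_intertwined {M N : FDMod ℂ Λ} {T : M.carrier →ₗ[ℂ] N.carrier} {t : Λ} :
    t ∈ intertwined T ↔ ∀ x, T (M.act t x) = N.act t (T x) := Iff.rfl

/-- A linear map that commutes with the action of a unit commutes with that of its inverse. -/
theorem mem_intertwined_of_mul_eq_one {M N : FDMod ℂ Λ} {T : M.carrier →ₗ[ℂ] N.carrier}
    {t t' : Λ} (h1 : t * t' = 1) (h2 : t' * t = 1) (ht : t ∈ intertwined T) :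
    t' ∈ intertwined T := by
  intro x
  have hM : M.act t (M.act t' x) = x := by
    rw [← Module.End.mul_apply, ← map_mul, h1, map_one, Module.End.one_apply]
  have hN : ∀ y, N.act t' (N.act t y) = y := fun y => by
    rw [← Module.End.mul_apply, ← map_mul, h2, map_one, Module.End.one_apply]
  rw [← hN (T (M.act t' x)), ← ht, hM]

end Equivariance

theorem finrank_tensor_eq_sum (n m : ℕ) :
    Module.finrank ℂ ((Fin (n + 1) → ℂ) ⊗[ℂ] (Fin (m + 1) → ℂ)) =
      ∑ l : Fin (min n m + 1), (n + m - 2 * (l : ℕ) + 1) := by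
  have key : ∀ k : ℕ, k ≤ min n m + 1 →
      ∑ l ∈ Finset.range k, (n + m - 2 * l + 1) + k * k = k * (n + m + 2) := by
    intro k hk
    induction k with
    | zero => simp
    | succ k ih =>
      obtain ⟨d, hd⟩ := Nat.exists_eq_add_of_le (show 2 * k ≤ n + m by omega)
      have ih := ih (by omega)
      rw [Finset.sum_range_succ, hd, Nat.add_sub_cancel_left]
      rw [hd] at ih
      linarith
  rw [Module.finrank_tensorProduct, Module.finrank_fin_fun, Module.finrank_fin_fun,
    Fin.sum_univ_eq_sum_range (fun l => n + m - 2 * l + 1)]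
  have h := key _ le_rfl
  rcases le_total n m with hnm | hnm
  · rw [min_eq_left hnm] at h ⊢
    linarith
  · rw [min_eq_right hnm] at h ⊢
    linarith

theorem injective_top_weight (n m : ℕ) :
    Function.Injective fun l : Fin (min n m + 1) => n + m - 2 * (l : ℕ) := by
  intro l l' h
  have h1 := l.2
  have h2 := l'.2
  have : n + m - 2 * (l : ℕ) = n + m - 2 * (l' : ℕ) := h
  exact Fin.ext (by omega)

/-! ### The enveloping algebra of `sl₂` -/

section Classical

attribute [local instance] LieRing.ofAssociativeRing

/-- The matrix `a H + b X + c Y` of `sl₂`. -/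
def slMatrix (a b c : ℂ) : LieAlgebra.SpecialLinear.sl (Fin 2) ℂ :=
  ⟨!![a, b; c, -a], by
    change Matrix.trace !![a, b; c, -a] = 0
    simp [Matrix.trace_fin_two]⟩

/-- The element `X` of `U(sl₂)`. -/
def envX : Usl2 := UniversalEnvelopingAlgebra.ι ℂ (slMatrix 0 1 0)

/-- The element `Y` of `U(sl₂)`. -/
def envY : Usl2 := UniversalEnvelopingAlgebra.ι ℂ (slMatrix 0 0 1)

/-- The element `H` of `U(sl₂)`. -/
def envH : Usl2 := UniversalEnvelopingAlgebra.ι ℂ (slMatrix 1 0 0)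

theorem ι_eq (A : LieAlgebra.SpecialLinear.sl (Fin 2) ℂ) :
    UniversalEnvelopingAlgebra.ι ℂ A = A.1 0 0 • envH + A.1 0 1 • envX + A.1 1 0 • envY := by
  unfold envH envX envY
  rw [← map_smul, ← map_smul, ← map_smul, ← map_add, ← map_add]
  congr 1
  have hA : A.1 1 1 = - A.1 0 0 := by
    have : Matrix.trace A.1 = 0 := A.2
    rw [Matrix.trace_fin_two] at this
    linear_combination this
  refine Subtype.ext ?_
  change A.1 = A.1 0 0 • (slMatrix 1 0 0).1 + A.1 0 1 • (slMatrix 0 1 0).1 +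
    A.1 1 0 • (slMatrix 0 0 1).1
  ext i j
  fin_cases i <;> fin_cases j <;> simp [hA, slMatrix]

theorem env_bracket {A B C : LieAlgebra.SpecialLinear.sl (Fin 2) ℂ} {t : ℂ}
    (h : A.1 * B.1 - B.1 * A.1 = t • C.1) :
    UniversalEnvelopingAlgebra.ι ℂ A * UniversalEnvelopingAlgebra.ι ℂ B -
      UniversalEnvelopingAlgebra.ι ℂ B * UniversalEnvelopingAlgebra.ι ℂ A =
      t • UniversalEnvelopingAlgebra.ι ℂ C := by
  rw [← LieRing.of_associative_ring_bracket, ← LieHom.map_lie, ← map_smul]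
  congr 1
  exact Subtype.ext h

theorem envX_envY : envX * envY - envY * envX = envH := by
  rw [← one_smul ℂ envH]
  refine env_bracket ?_
  ext i j
  fin_cases i <;> fin_cases j <;> simp [slMatrix]

theorem envH_envY : envH * envY - envY * envH = (-2 : ℂ) • envY := by
  refine env_bracket ?_
  ext i j
  fin_cases i <;> fin_cases j <;> simp [slMatrix]
  norm_num

theorem mem_of_env_generators (S : Subalgebra ℂ Usl2) (hX : envX ∈ S) (hY : envY ∈ S)
    (hH : envH ∈ S) (t : Usl2) : t ∈ S := by
  have hι : ∀ A : LieAlgebra.SpecialLinear.sl (Fin 2) ℂ,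
      UniversalEnvelopingAlgebra.ι ℂ A ∈ S := fun A => by
    rw [ι_eq]
    exact add_mem (add_mem (S.smul_mem hH _) (S.smul_mem hX _)) (S.smul_mem hY _)
  let g : LieAlgebra.SpecialLinear.sl (Fin 2) ℂ →ₗ⁅ℂ⁆ S :=
    { toFun := fun A => ⟨UniversalEnvelopingAlgebra.ι ℂ A, hι A⟩
      map_add' := fun A B => Subtype.ext (map_add _ A B)
      map_smul' := fun r A => Subtype.ext (map_smul _ r A)
      map_lie' := fun {A B} => Subtype.ext (LieHom.map_lie _ A B) }
  have hid : S.val.comp (UniversalEnvelopingAlgebra.lift ℂ g) = AlgHom.id ℂ Usl2 :=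
    env_hom_ext ℂ _ fun A => by
      rw [AlgHom.comp_apply, UniversalEnvelopingAlgebra.lift_ι_apply]
      rfl
  have h := DFunLike.congr_fun hid t
  rw [AlgHom.id_apply] at h
  rw [← h]
  exact Subtype.property _

theorem env_equivariant {M N : FDMod ℂ Usl2} (T : M.carrier →ₗ[ℂ] N.carrier)
    (hX : ∀ x, T (M.act envX x) = N.act envX (T x))
    (hY : ∀ x, T (M.act envY x) = N.act envY (T x))
    (hH : ∀ x, T (M.act envH x) = N.act envH (T x)) (t : Usl2) (x : M.carrier) :
    T (M.act t x) = N.act t (T x) :=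
  mem_intertwined.1 (mem_of_env_generators (intertwined T) hX hY hH t) x

/-- The action of `U(sl₂)` on `V(n)`, on the concrete space of coordinates. -/
def envRep (n : ℕ) : Usl2 →ₐ[ℂ] Module.End ℂ (Fin (n + 1) → ℂ) :=
  UniversalEnvelopingAlgebra.lift ℂ (sl2Rep n)

theorem envRep_ι (n : ℕ) (A : LieAlgebra.SpecialLinear.sl (Fin 2) ℂ) :
    envRep n (UniversalEnvelopingAlgebra.ι ℂ A) =
      A.1 0 0 • opH n + A.1 0 1 • opX n + A.1 1 0 • opY n :=
  UniversalEnvelopingAlgebra.lift_ι_apply ℂ _ A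

theorem envRep_X (n : ℕ) : envRep n envX = opX n := by
  rw [envX, envRep_ι]
  simp [slMatrix]

theorem envRep_Y (n : ℕ) : envRep n envY = opY n := by
  rw [envY, envRep_ι]
  simp [slMatrix]

theorem envRep_H (n : ℕ) : envRep n envH = opH n := by
  rw [envH, envRep_ι]
  simp [slMatrix]

theorem isString_V (p : ℕ) : IsString p (envRep p envX) (envRep p envY) (envRep p envH)
    (fun i => (p : ℂ) - i + 1) (fun i => (i : ℂ) + 1) (fun i => (p : ℂ) - 2 * i) where
  E_vec i := by rw [envRep_X, opX_vec]
  F_vec i := by rw [envRep_Y, opY_vec]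
  H_vec i := by rw [envRep_H, opH_vec]
  a_eq_zero_iff i := by
    rw [show (p : ℂ) - i + 1 = ((p - i + 1 : ℤ) : ℂ) by push_cast; ring, Int.cast_eq_zero]
    omega
  b_eq_zero_iff i := by
    rw [show (i : ℂ) + 1 = ((i + 1 : ℤ) : ℂ) by push_cast; ring, Int.cast_eq_zero]
    omega
  c_injective i j hij := by
    have : (i : ℂ) = j := by linear_combination (-1 / 2 : ℂ) * hij
    exact_mod_cast this

theorem tensorRep_ι {A B : Type} [AddCommGroup A] [Module ℂ A] [AddCommGroup B] [Module ℂ B]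
    (ρ : Usl2 →ₐ[ℂ] Module.End ℂ A) (σ : Usl2 →ₐ[ℂ] Module.End ℂ B)
    (x : LieAlgebra.SpecialLinear.sl (Fin 2) ℂ) (u : A) (w : B) :
    FDMod.tensorRep ρ σ (UniversalEnvelopingAlgebra.ι ℂ x) (u ⊗ₜ w) =
      ρ (UniversalEnvelopingAlgebra.ι ℂ x) u ⊗ₜ w +
        u ⊗ₜ σ (UniversalEnvelopingAlgebra.ι ℂ x) w := by
  have h : Coalgebra.comul (R := ℂ) (UniversalEnvelopingAlgebra.ι ℂ x : Usl2) =
      UniversalEnvelopingAlgebra.ι ℂ x ⊗ₜ 1 + 1 ⊗ₜ UniversalEnvelopingAlgebra.ι ℂ x :=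
    envComul_ι ℂ _ x
  rw [FDMod.tensorRep_apply, h, map_add, LinearMap.add_apply, FDMod.tensorAct_tmul,
    FDMod.tensorAct_tmul, map_one, map_one, Module.End.one_apply, Module.End.one_apply]

theorem tensor_V_iso (n m : ℕ) : ((V n).tensor (V m)).Iso
    (FDMod.directSum fun l : Fin (min n m + 1) => V (n + m - 2 * (l : ℕ))) := by
  refine iso_directSum_of_highest_weight envX envY envH env_equivariant envRep _ _ _ isString_V
    ((V n).tensor (V m)) ?_ ?_ (fun l : Fin (min n m + 1) => n + m - 2 * (l : ℕ)) ?_ ?_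
    (finrank_tensor_eq_sum n m)
  · intro p i x hx
    have h := LinearMap.congr_fun (congrArg ((V n).tensor (V m)).act envH_envY) x
    rw [map_sub, map_mul, map_mul, map_smul, LinearMap.sub_apply, Module.End.mul_apply,
      Module.End.mul_apply, hx, map_smul, LinearMap.smul_apply, sub_eq_iff_eq_add,
      ← add_smul] at h
    rw [h]
    congr 1
    push_cast
    ring
  · intro p i x hx
    have h := LinearMap.congr_fun (congrArg ((V n).tensor (V m)).act envX_envY) x
    rw [map_sub, map_mul, map_mul, LinearMap.sub_apply, Module.End.mul_apply,
      Module.End.mul_apply, hx] at h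
    rw [h]
    congr 1
    push_cast
    ring
  · intro l l' h
    refine injective_top_weight n m (?_ : n + m - 2 * (l : ℕ) = n + m - 2 * (l' : ℕ))
    simpa using h
  · intro l
    have hl := l.2
    obtain ⟨w, hw0, hX, hH⟩ := exists_highest_weight
      (FDMod.tensorRep (envRep n) (envRep m) envX) (FDMod.tensorRep (envRep n) (envRep m) envH)
      (fun i _ => (n : ℂ) - i + 1) (fun _ j => (m : ℂ) - j + 1) (fun s => (n : ℂ) + m - 2 * s)
      (fun i j => by
        rw [envX, tensorRep_ι, ← envX, envRep_X, envRep_X, opX_vec, opX_vec,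
          TensorProduct.smul_tmul', TensorProduct.tmul_smul])
      (fun i j => by
        rw [envH, tensorRep_ι, ← envH, envRep_H, envRep_H, opH_vec, opH_vec,
          ← TensorProduct.smul_tmul', TensorProduct.tmul_smul, ← add_smul]
        congr 1
        push_cast
        ring)
      (fun i j h1 h2 h => by
        rw [show (n : ℂ) - i + 1 = ((n - i + 1 : ℤ) : ℂ) by push_cast; ring,
          Int.cast_eq_zero] at h
        omega)
      (l := l) (by omega) (by omega)
    refine ⟨w, hw0, hX, hH.trans ?_⟩
    congr 1
    rw [Nat.cast_sub (by omega)]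
    push_cast
    ring

theorem V_zero_iso_unit : (V 0).Iso (FDMod.unit ℂ Usl2) := by
  refine ⟨LinearEquiv.funUnique (Fin 1) ℂ ℂ, ?_⟩
  have h0 : ∀ A : LieAlgebra.SpecialLinear.sl (Fin 2) ℂ,
      (V 0).act (UniversalEnvelopingAlgebra.ι ℂ A) = 0 := fun A => by
    refine (envRep_ι 0 A).trans (end_ext fun i hi hi' => ?_)
    obtain rfl : i = 0 := by omega
    simp [opH_vec, opX_vec, opY_vec, vec_eq_zero]
    rfl
  have h1 : ∀ A : LieAlgebra.SpecialLinear.sl (Fin 2) ℂ,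
      (FDMod.unit ℂ Usl2).act (UniversalEnvelopingAlgebra.ι ℂ A) = 0 := fun A => by
    have hcounit : Coalgebra.counit (R := ℂ) (UniversalEnvelopingAlgebra.ι ℂ A : Usl2) = 0 :=
      envCounit_ι ℂ _ A
    have hunit : FDMod.unitRep ℂ Usl2 (UniversalEnvelopingAlgebra.ι ℂ A) = 0 :=
      LinearMap.ext fun x => by
        rw [FDMod.unitRep_apply, hcounit, zero_mul, LinearMap.zero_apply]
    exact hunit
  let T : (V 0).carrier →ₗ[ℂ] (FDMod.unit ℂ Usl2).carrier :=
    (LinearEquiv.funUnique (Fin 1) ℂ ℂ).toLinearMap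
  have hT : ∀ A x, T ((V 0).act (UniversalEnvelopingAlgebra.ι ℂ A) x) =
      (FDMod.unit ℂ Usl2).act (UniversalEnvelopingAlgebra.ι ℂ A) (T x) := fun A x => by
    rw [h0, h1, LinearMap.zero_apply, LinearMap.zero_apply, map_zero]
  exact env_equivariant T (hT _) (hT _) (hT _)

theorem exists_subring_V :
    ∃ (S : Subring (GrothendieckRing ℂ Usl2)) (b : Module.Basis (ZMod 1 × J ⊤) ℤ S),
      (∀ n : ℕ, ((sym b 0 (n : ℤ) : S) : GrothendieckRing ℂ Usl2) = (V n).cls) ∧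
        TensorAxioms b := by
  refine exists_subring_tensorAxioms (fun n => (V n).cls) ?_ ?_ fun n m => ?_
  · refine linearIndependent_cls envX envY envH envRep _ _ _ isString_V fun p p' h => ?_
    simpa using h
  · exact cls_eq_of_iso V_zero_iso_unit
  · rw [← cls_tensor, cls_eq_of_iso (tensor_V_iso n m), cls_directSum]

end Classical

/-! ### The quantum enveloping algebra of `sl₂` -/

section QuantumCase

variable {q : ℂˣ}

theorem zpow_injective_of_not_root (hq : ∀ N : ℕ, 0 < N → q ^ N ≠ 1) :
    Function.Injective fun i : ℤ => (q : ℂ) ^ i := by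
  intro i j hij
  have h : q ^ i = q ^ j := Units.ext (by simpa using hij)
  exact (injective_zpow_iff_not_isOfFinOrder (x := q)).2 (fun hfin => by
    obtain ⟨N, hN, h1⟩ := isOfFinOrder_iff_pow_eq_one.1 hfin
    exact hq N hN h1) h

theorem sub_inv_ne_zero_of_not_root (hq : ∀ N : ℕ, 0 < N → q ^ N ≠ 1) :
    (q : ℂ) - (q : ℂ)⁻¹ ≠ 0 := fun h => by
  have h1 : (q : ℂ) ^ (1 : ℤ) = (q : ℂ) ^ (-1 : ℤ) := by
    rw [zpow_one, zpow_neg_one]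
    exact sub_eq_zero.1 h
  have := zpow_injective_of_not_root hq h1
  omega

theorem qInt_eq_zero_iff (hq : ∀ N : ℕ, 0 < N → q ^ N ≠ 1) (z : ℤ) : qInt q z = 0 ↔ z = 0 := by
  constructor
  · intro h
    have h1 := sub_eq_zero.1 ((div_eq_zero_iff.1 h).resolve_right (sub_inv_ne_zero_of_not_root hq))
    have := zpow_injective_of_not_root hq h1
    omega
  · rintro rfl
    exact qInt_zero q

theorem sign_ne_zero (ε : ℤˣ) : ((ε : ℤ) : ℂ) ≠ 0 := by
  exact_mod_cast ε.ne_zero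

theorem mem_of_gen_mem (S : Subalgebra ℂ (Uq q)) (hS : ∀ g, Uq.gen q g ∈ S) (t : Uq q) :
    t ∈ S := by
  let f : Gen → S := fun g => ⟨Uq.gen q g, hS g⟩
  let φ : Uq q →ₐ[ℂ] S := Uq.lift q f (Subtype.ext (Uq.K_Kinv q)) (Subtype.ext (Uq.Kinv_K q))
    (Subtype.ext (Uq.K_E q)) (Subtype.ext (Uq.K_F q)) (Subtype.ext (Uq.E_F q))
  have hid : S.val.comp φ = AlgHom.id ℂ (Uq q) := Uq.hom_ext q fun g => by
    rw [AlgHom.comp_apply, Uq.lift_gen]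
    rfl
  have h := DFunLike.congr_fun hid t
  rw [AlgHom.id_apply] at h
  rw [← h]
  exact Subtype.property _

theorem uq_equivariant {M N : FDMod ℂ (Uq q)} (T : M.carrier →ₗ[ℂ] N.carrier)
    (hE : ∀ x, T (M.act (Uq.gen q .E) x) = N.act (Uq.gen q .E) (T x))
    (hF : ∀ x, T (M.act (Uq.gen q .F) x) = N.act (Uq.gen q .F) (T x))
    (hK : ∀ x, T (M.act (Uq.gen q .K) x) = N.act (Uq.gen q .K) (T x)) (t : Uq q)
    (x : M.carrier) : T (M.act t x) = N.act t (T x) := by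
  refine mem_intertwined.1 (mem_of_gen_mem (intertwined T) (fun g => ?_) t) x
  cases g with
  | E => exact hE
  | F => exact hF
  | K => exact hK
  | Kinv => exact mem_intertwined_of_mul_eq_one (Uq.K_Kinv q) (Uq.Kinv_K q) hK

theorem isString_Vq (hq : ∀ N : ℕ, 0 < N → q ^ N ≠ 1) (ε : ℤˣ) (p : ℕ) :
    IsString p (qRep q ε p (Uq.gen q .E)) (qRep q ε p (Uq.gen q .F)) (qRep q ε p (Uq.gen q .K))
      (fun i => ((ε : ℤ) : ℂ) * qInt q (p - i + 1)) (fun i => qInt q (i + 1))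
      (fun i => ((ε : ℤ) : ℂ) * (q : ℂ) ^ ((p : ℤ) - 2 * i)) where
  E_vec i := by
    rw [qRep_gen]
    exact qE_vec q ε p i
  F_vec i := by
    rw [qRep_gen]
    exact qF_vec q p i
  H_vec i := by
    rw [qRep_gen]
    exact qK_vec q ε p i
  a_eq_zero_iff i := by
    rw [mul_eq_zero, or_iff_right (sign_ne_zero ε), qInt_eq_zero_iff hq]
    omega
  b_eq_zero_iff i := by
    rw [qInt_eq_zero_iff hq]
    omega
  c_injective i j hij := by
    have := zpow_injective_of_not_root hq (mul_left_cancel₀ (sign_ne_zero ε) hij)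
    omega

section TensorRep

variable {A B : Type} [AddCommGroup A] [Module ℂ A] [AddCommGroup B] [Module ℂ B]
  (ρ : Uq q →ₐ[ℂ] Module.End ℂ A) (σ : Uq q →ₐ[ℂ] Module.End ℂ B) (u : A) (w : B)

theorem tensorRep_gen (g : Gen) :
    FDMod.tensorRep ρ σ (Uq.gen q g) = FDMod.tensorAct ρ σ (Uq.comulGen q g) := by
  have h : Coalgebra.comul (R := ℂ) (Uq.gen q g) = Uq.comulGen q g := Uq.comul_gen q g
  rw [FDMod.tensorRep_apply, h]

theorem tensorRep_E : FDMod.tensorRep ρ σ (Uq.gen q .E) (u ⊗ₜ w) =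
    u ⊗ₜ σ (Uq.gen q .E) w + ρ (Uq.gen q .E) u ⊗ₜ σ (Uq.gen q .K) w := by
  rw [tensorRep_gen, Uq.comulGen, map_add, LinearMap.add_apply, FDMod.tensorAct_tmul,
    FDMod.tensorAct_tmul, map_one, Module.End.one_apply]

theorem tensorRep_K : FDMod.tensorRep ρ σ (Uq.gen q .K) (u ⊗ₜ w) =
    ρ (Uq.gen q .K) u ⊗ₜ σ (Uq.gen q .K) w := by
  rw [tensorRep_gen, Uq.comulGen, FDMod.tensorAct_tmul]

end TensorRep

section Weights

variable (M : FDMod ℂ (Uq q)) (ε : ℤˣ) (p i : ℤ) (x : M.carrier)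
  (hx : M.act (Uq.gen q .K) x = (((ε : ℤ) : ℂ) * (q : ℂ) ^ (p - 2 * i)) • x)

include hx in
theorem K_F_weight : M.act (Uq.gen q .K) (M.act (Uq.gen q .F) x) =
    (((ε : ℤ) : ℂ) * (q : ℂ) ^ (p - 2 * (i + 1))) • M.act (Uq.gen q .F) x := by
  have h := LinearMap.congr_fun (congrArg M.act (Uq.K_F q)) x
  rw [map_smul, map_mul, map_mul, LinearMap.smul_apply, Module.End.mul_apply,
    Module.End.mul_apply, hx, map_smul, smul_smul] at h
  rw [h, show p - 2 * (i + 1) = -2 + (p - 2 * i) by ring, zpow_add₀ q.ne_zero]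
  congr 1
  ring

include hx in
theorem Kinv_weight :
    M.act (Uq.gen q .Kinv) x = (((ε : ℤ) : ℂ) * (q : ℂ) ^ (-(p - 2 * i))) • x := by
  have h := LinearMap.congr_fun (congrArg M.act (Uq.Kinv_K q)) x
  rw [map_mul, map_one, Module.End.mul_apply, Module.End.one_apply, hx, map_smul] at h
  conv_rhs => rw [← h]
  rw [smul_smul, mul_mul_mul_comm, sign_sq, ← zpow_add₀ q.ne_zero, neg_add_cancel, zpow_zero,
    one_mul, one_smul]

include hx in
theorem E_F_weight :
    M.act (Uq.gen q .E) (M.act (Uq.gen q .F) x) - M.act (Uq.gen q .F) (M.act (Uq.gen q .E) x) =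
      (((ε : ℤ) : ℂ) * qInt q (p - (i + 1) + 1) * qInt q (i + 1) -
        qInt q (i - 1 + 1) * (((ε : ℤ) : ℂ) * qInt q (p - i + 1))) • x := by
  have h := LinearMap.congr_fun (congrArg M.act (Uq.E_F q)) x
  rw [map_sub, map_mul, map_mul, map_smul, map_sub, LinearMap.smul_apply, LinearMap.sub_apply,
    LinearMap.sub_apply, Module.End.mul_apply, Module.End.mul_apply, hx,
    Kinv_weight M ε p i x hx, ← sub_smul, smul_smul] at h
  rw [h]
  congr 1
  rw [show p - (i + 1) + 1 = p - i by ring, sub_add_cancel]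
  linear_combination -((ε : ℤ) : ℂ) * qInt_identity q p i

end Weights

theorem tensor_Vq_iso (hq : ∀ N : ℕ, 0 < N → q ^ N ≠ 1) (ε ε' : ℤˣ) (n m : ℕ) :
    ((Vq q ε n).tensor (Vq q ε' m)).Iso
      (FDMod.directSum fun l : Fin (min n m + 1) => Vq q (ε * ε') (n + m - 2 * (l : ℕ))) := by
  refine iso_directSum_of_highest_weight (Uq.gen q .E) (Uq.gen q .F) (Uq.gen q .K) uq_equivariant
    (qRep q (ε * ε')) _ _ _ (isString_Vq hq (ε * ε')) ((Vq q ε n).tensor (Vq q ε' m))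
    (fun p i => K_F_weight _ _ _ _) (fun p i => E_F_weight _ _ _ _)
    (fun l : Fin (min n m + 1) => n + m - 2 * (l : ℕ)) ?_ ?_ (finrank_tensor_eq_sum n m)
  · intro l l' h
    have h1 := zpow_injective_of_not_root hq (mul_left_cancel₀ (sign_ne_zero (ε * ε')) h)
    refine injective_top_weight n m (?_ : n + m - 2 * (l : ℕ) = n + m - 2 * (l' : ℕ))
    omega
  · intro l
    have hl := l.2
    obtain ⟨w, hw0, hE, hK⟩ := exists_highest_weight
      (FDMod.tensorRep (qRep q ε n) (qRep q ε' m) (Uq.gen q .E))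
      (FDMod.tensorRep (qRep q ε n) (qRep q ε' m) (Uq.gen q .K))
      (fun i j => ((ε : ℤ) : ℂ) * qInt q (n - i + 1) *
        (((ε' : ℤ) : ℂ) * (q : ℂ) ^ ((m : ℤ) - 2 * j)))
      (fun _ j => ((ε' : ℤ) : ℂ) * qInt q (m - j + 1))
      (fun s => (((ε * ε' : ℤˣ) : ℤ) : ℂ) * (q : ℂ) ^ ((n : ℤ) + m - 2 * s))
      (fun i j => by
        rw [tensorRep_E, (isString_Vq hq ε' m).E_vec, (isString_Vq hq ε n).E_vec,
          (isString_Vq hq ε' m).H_vec, TensorProduct.smul_tmul_smul, TensorProduct.tmul_smul]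
        exact add_comm _ _)
      (fun i j => by
        rw [tensorRep_K, (isString_Vq hq ε' m).H_vec, (isString_Vq hq ε n).H_vec,
          TensorProduct.smul_tmul_smul]
        congr 1
        rw [show (n : ℤ) + m - 2 * (i + j) = (n - 2 * i) + (m - 2 * j) by ring,
          zpow_add₀ q.ne_zero]
        push_cast
        ring)
      (fun i j h1 h2 => by
        refine mul_ne_zero (mul_ne_zero (sign_ne_zero ε) fun h => ?_)
          (mul_ne_zero (sign_ne_zero ε') (zpow_ne_zero _ q.ne_zero))
        have := (qInt_eq_zero_iff hq _).1 h
        omega)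
      (l := l) (by omega) (by omega)
    refine ⟨w, hw0, hE, hK.trans ?_⟩
    congr 3
    omega

theorem Vq_zero_iso_unit : (Vq q 1 0).Iso (FDMod.unit ℂ (Uq q)) := by
  refine ⟨LinearEquiv.funUnique (Fin 1) ℂ ℂ, ?_⟩
  have h0 : ∀ g : Gen, (Vq q 1 0).act (Uq.gen q g) = Uq.counitGen g • LinearMap.id := fun g => by
    refine (qRep_gen q 1 0 g).trans (end_ext fun i hi hi' => ?_)
    obtain rfl : i = 0 := by omega
    cases g <;> simp [qOp, qE_vec, qF_vec, qK_vec, qKinv_vec, vec_eq_zero, Uq.counitGen] <;> rfl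
  have h1 : ∀ g : Gen,
      (FDMod.unit ℂ (Uq q)).act (Uq.gen q g) = Uq.counitGen g • LinearMap.id := fun g => by
    have hcounit : Coalgebra.counit (R := ℂ) (Uq.gen q g) = Uq.counitGen g := Uq.counit_gen q g
    have hunit : FDMod.unitRep ℂ (Uq q) (Uq.gen q g) = Uq.counitGen g • LinearMap.id :=
      LinearMap.ext fun x => by
        rw [FDMod.unitRep_apply, hcounit, LinearMap.smul_apply, LinearMap.id_apply, smul_eq_mul]
    exact hunit
  let T : (Vq q 1 0).carrier →ₗ[ℂ] (FDMod.unit ℂ (Uq q)).carrier :=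
    (LinearEquiv.funUnique (Fin 1) ℂ ℂ).toLinearMap
  have hT : ∀ g x, T ((Vq q 1 0).act (Uq.gen q g) x) =
      (FDMod.unit ℂ (Uq q)).act (Uq.gen q g) (T x) := fun g x => by
    rw [h0, h1, LinearMap.smul_apply, LinearMap.smul_apply, map_smul, LinearMap.id_apply,
      LinearMap.id_apply]
  exact uq_equivariant T (hT _) (hT _) (hT _)

theorem exists_subring_Vq (hq : ∀ N : ℕ, 0 < N → q ^ N ≠ 1) :
    ∃ (S : Subring (GrothendieckRing ℂ (Uq q))) (b : Module.Basis (ZMod 1 × J ⊤) ℤ S),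
      (∀ n : ℕ, ((sym b 0 (n : ℤ) : S) : GrothendieckRing ℂ (Uq q)) = (Vq q 1 n).cls) ∧
        TensorAxioms b := by
  refine exists_subring_tensorAxioms (fun n => (Vq q 1 n).cls) ?_ ?_ fun n m => ?_
  · refine linearIndependent_cls (Uq.gen q .E) (Uq.gen q .F) (Uq.gen q .K) (qRep q 1) _ _ _
      (isString_Vq hq 1) fun p p' h => ?_
    have := zpow_injective_of_not_root hq (mul_left_cancel₀ (sign_ne_zero 1) h)
    omega
  · exact cls_eq_of_iso Vq_zero_iso_unit
  · rw [← cls_tensor, cls_eq_of_iso (tensor_Vq_iso hq 1 1 n m), cls_directSum, one_mul]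

end QuantumCase

end ClebschGordan

end

open ClebschGordan
theorem proposition3p2 :
    -- the axiomatisation with `I = {0}` (that is, `ℤ/1ℤ`) and `m = ∞` yields the formula
    (∀ (R : Type*) [Ring R] (b : Module.Basis (ZMod 1 × J ⊤) ℤ R), TensorAxioms b →
      ∀ x y : ℕ, sym b 0 (x : ℤ) * sym b 0 (y : ℤ) =
        ∑ l ∈ Finset.range (min x y + 1), sym b 0 ((x : ℤ) + (y : ℤ) - 2 * (l : ℤ))) ∧
    -- the classes `[V(n)]` satisfy it in the Grothendieck ring of `U(sl₂)`
    (∃ (S : Subring (GrothendieckRing ℂ Usl2)) (b : Module.Basis (ZMod 1 × J ⊤) ℤ S),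
      (∀ n : ℕ, ((sym b 0 (n : ℤ) : S) : GrothendieckRing ℂ Usl2) = (V n).cls) ∧
        TensorAxioms b) ∧
    -- the Clebsch-Gordan formula for `U(sl₂)`
    (∀ n m : ℕ, ((V n).tensor (V m)).Iso
      (FDMod.directSum fun l : Fin (min n m + 1) => V (n + m - 2 * (l : ℕ)))) ∧
    ∀ q : ℂˣ, (∀ N : ℕ, 0 < N → q ^ N ≠ 1) →
      -- the classes `[V_{1,n}]` satisfy it in the Grothendieck ring of `U_q(sl₂)`
      (∃ (S : Subring (GrothendieckRing ℂ (Uq q))) (b : Module.Basis (ZMod 1 × J ⊤) ℤ S),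
        (∀ n : ℕ, ((sym b 0 (n : ℤ) : S) : GrothendieckRing ℂ (Uq q)) = (Vq q 1 n).cls) ∧
          TensorAxioms b) ∧
      -- the Clebsch-Gordan formula for `U_q(sl₂)`
      (∀ (ε ε' : ℤˣ) (n m : ℕ), ((Vq q ε n).tensor (Vq q ε' m)).Iso
        (FDMod.directSum fun l : Fin (min n m + 1) =>
          Vq q (ε * ε') (n + m - 2 * (l : ℕ)))) :=
  ⟨fun _ _ _ hb x y => sym_mul_sym hb x y, exists_subring_V, tensor_V_iso,
    fun _ hq => ⟨exists_subring_Vq hq, tensor_Vq_iso hq⟩⟩
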